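/- **Conventions.** Let $M$ be a smooth manifold (without boundary) and $T^{big}M=TM\oplus T^*M$, with the neutral metric $g((X,\alpha),(Y,\beta))=\frac12(\alpha(Y)+\beta(X))$ and the Courant bracket $$[(X,\alpha),(Y,\beta)]=\big([X,Y],\,L_X\beta-L_Y\alpha+\tfrac12 d(\alpha(Y)-\beta(X))\big).$$ A generalized almost complex structure is a smooth bundle endomorphism $\Phi$ of $T^{big}M$ with $\Phi^2=-Id$ and $g(\mathcal X,\Phi\mathcal Y)+g(\Phi\mathcal X,\mathcal Y)=0$. It is integrable if $$\mathcal N_\Phi(\mathcal X,\mathcal Y)=[\Phi\mathcal X,\Phi\mathcal Y]-\Phi[\mathcal X,\Phi\mathcal Y]-\Phi[\Phi\mathcal X,\mathcal Y]+\Phi^2[\mathcal X,\mathcal Y]=0$$ for all smooth (local) sections $\mathcal X,\mathcal Y$, with Courant brackets. Write $$\Phi(X,\alpha)=(AX+\sharp_\pi\alpha,\ \flat_\sigma X-\alpha\circ A),$$ with $A\in End(TM)$, a bivector field $\pi$, $\pi(\alpha,\beta)=\beta(\sharp_\pi\alpha)$, and a 2-form $\sigma$, $\flat_\sigma X=\sigma(X,\cdot)$;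 put $\sigma_A(X,Y)=\sigma(AX,Y)$. For $\tau\in C^\infty$ let $\mathcal C_\tau(X,\alpha)=(X,e^\tau\alpha)$. $\Phi$ is *globally conformal integrable* if $\mathcal C_{-\tau}\circ\Phi\circ\mathcal C_\tau$ is integrable for some $\tau\in C^\infty(M)$, and *locally conformal integrable* if every point has an open neighbourhood $U$ and a $\tau\in C^\infty(U)$ such that $\mathcal C_{-\tau}\circ\Phi|_U\circ\mathcal C_\tau$ is integrable on $U$. For a 1-form $\varpi$ consider the conditions, for all smooth (local) 1-forms $\alpha$ and vector fields $X,Y,Z$: (i) $[\pi,\pi]=-2(\sharp_\pi\varpi)\wedge\pi$; (ii) $R_{(\pi,A)}(\alpha,X)=\varpi(X)\,A\sharp_\pi\alpha-\varpi(AX)\,\sharp_\pi\alpha$, where $R_{(\pi,A)}(\alpha,X)=\sharp_\pi(L_X(\alpha\circ A)-L_{AX}\alpha)-(L_{\sharp_\pi\alpha}A)(X)$; (iii) $\mathcal N_A(X,Y)-\sharp_\pi[i(X\wedge Y)d\sigma]=-\sigma(X,Y)\sharp_\pi\varpi+\varpi(X)(Id+A^2)(Y)-\varpi(Y)(Id+A^2)(X)$;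 (iv) $d\sigma_A(X,Y,Z)-\sum_{Cycl(X,Y,Z)}d\sigma(AX,Y,Z)=-[\varpi\wedge\sigma_A+(\varpi\circ A)\wedge\sigma](X,Y,Z)$. Here $\mathcal N_A$ is the Nijenhuis tensor of $A$ (the formula for $\mathcal N_\Phi$ with Lie brackets), $i(X\wedge Y)d\sigma=d\sigma(X,Y,\cdot)$, wedge products follow $(\varpi\wedge\sigma)(X,Y,Z)=\sum_{Cycl}\varpi(X)\sigma(Y,Z)$, and the sign of the Schouten-Nijenhuis bracket is such that $[\pi,\pi](df,dh,dk)=2\sum_{Cycl(f,h,k)}\{\{f,h\},k\}$ with $\{f,h\}=\pi(df,dh)$. **Theorem.** Let $\Phi$ be a generalized almost complex structure on a manifold $M$ with $\dim M>2$. Assume that one of the following holds: 1) $\pi$ is non degenerate at every point; 2) for every $x\in M$, $A_x^2\neq-Id$ and $A_x$ has no real eigenvalue; 3) at every point $\operatorname{rank}\pi>2$ and $\sigma$ is non degenerate. Then $\Phi$ is locally conformal integrable if and only if there exists a closed 1-form $\varpi\in\Omega^1(M)$ (the Lee form) satisfying (i)-(iv). Moreover, for any such $\varpi$, $\Phi$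 is globally conformal integrable if and only if $\varpi$ is exact. -/

import Mathlib

open scoped Manifold ContDiff

noncomputable section

namespace GenCx

open Bundle

/-- The fibre `T_x M ⊕ T_x^* M` of the big tangent bundle at `x`. -/
abbrev BigFiber (E : Type*) [NormedAddCommGroup E] [NormedSpace ℝ E]
    {M : Type*} [TopologicalSpace M] [ChartedSpace E M] (x : M) : Type _ :=
  TangentSpace 𝓘(ℝ, E) x × (TangentSpace 𝓘(ℝ, E) x →L[ℝ] ℝ)

/-- (Not necessarily smooth) vector fields. -/
abbrev VecField (E M : Type*) [NormedAddCommGroup E] [NormedSpace ℝ E]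
    [TopologicalSpace M] [ChartedSpace E M] : Type _ :=
  Π x : M, TangentSpace 𝓘(ℝ, E) x

/-- (Not necessarily smooth) 1-forms. -/
abbrev OneForm (E M : Type*) [NormedAddCommGroup E] [NormedSpace ℝ E]
    [TopologicalSpace M] [ChartedSpace E M] : Type _ :=
  Π x : M, TangentSpace 𝓘(ℝ, E) x →L[ℝ] ℝ

/-- (Not necessarily smooth) sections of the big tangent bundle. -/
abbrev BigField (E M : Type*) [NormedAddCommGroup E] [NormedSpace ℝ E]
    [TopologicalSpace M] [ChartedSpace E M] : Type _ :=
  Π x : M, BigFiber E x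

/-- (Not necessarily smooth) families of linear endomorphisms of the big tangent spaces. -/
abbrev BigEnd (E M : Type*) [NormedAddCommGroup E] [NormedSpace ℝ E]
    [TopologicalSpace M] [ChartedSpace E M] : Type _ :=
  Π x : M, BigFiber E x →ₗ[ℝ] BigFiber E x

section Smoothness

variable {E : Type*} [NormedAddCommGroup E] [NormedSpace ℝ E]
  {M : Type*} [TopologicalSpace M] [ChartedSpace E M] [IsManifold 𝓘(ℝ, E) ∞ M]

/-- The vector field `X` is `C^∞` on `U`. -/
def SmoothVecOn (X : VecField E M) (U : Set M) : Prop :=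
  ContMDiffOn 𝓘(ℝ, E) (𝓘(ℝ, E).prod 𝓘(ℝ, E)) ∞
    (fun x => (TotalSpace.mk' E x (X x) : TangentBundle 𝓘(ℝ, E) M)) U

/-- The 1-form `α` is `C^∞` on `U` (as a section of the cotangent bundle). -/
def SmoothFormOn (α : OneForm E M) (U : Set M) : Prop :=
  ContMDiffOn 𝓘(ℝ, E) (𝓘(ℝ, E).prod 𝓘(ℝ, E →L[ℝ] ℝ)) ∞
    (fun x => TotalSpace.mk' (E →L[ℝ] ℝ)
      (E := fun y : M => TangentSpace 𝓘(ℝ, E) y →L[ℝ] Bundle.Trivial M ℝ y) x (α x)) U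

/-- The section `ξ` of the big tangent bundle is `C^∞` on `U`. -/
def SmoothBigOn (ξ : BigField E M) (U : Set M) : Prop :=
  SmoothVecOn (fun x => (ξ x).1) U ∧ SmoothFormOn (fun x => (ξ x).2) U

end Smoothness

section Calculus

variable {E : Type*} [NormedAddCommGroup E] [NormedSpace ℝ E] [FiniteDimensional ℝ E]
  {M : Type*} [TopologicalSpace M] [ChartedSpace E M] [IsManifold 𝓘(ℝ, E) ∞ M]

/-- The covector `α ∘ A`. -/
def covComp {x : M} (α : TangentSpace 𝓘(ℝ, E) x →L[ℝ] ℝ)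
    (A : TangentSpace 𝓘(ℝ, E) x →ₗ[ℝ] TangentSpace 𝓘(ℝ, E) x) :
    TangentSpace 𝓘(ℝ, E) x →L[ℝ] ℝ where
  toLinearMap := (α : TangentSpace 𝓘(ℝ, E) x →ₗ[ℝ] ℝ) ∘ₗ A
  cont := by
    have : T2Space (TangentSpace 𝓘(ℝ, E) x) := inferInstanceAs (T2Space E)
    have : FiniteDimensional ℝ (TangentSpace 𝓘(ℝ, E) x) :=
      inferInstanceAs (FiniteDimensional ℝ E)
    exact α.continuous.comp (LinearMap.continuous_of_finiteDimensional A)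

/-- The Lie bracket `[X, Y]` of vector fields. -/
def lie (X Y : VecField E M) : VecField E M :=
  fun x => VectorField.mlieBracket 𝓘(ℝ, E) X Y x

/-- The derivative `X f` of a function along a vector field. -/
def dirDeriv (X : VecField E M) (f : M → ℝ) (x : M) : ℝ :=
  mvfderiv 𝓘(ℝ, E) f x (X x)

/-- The differential `df` of a function. -/
def diff (f : M → ℝ) : OneForm E M :=
  fun x => mvfderiv 𝓘(ℝ, E) f x

open Classical in
/-- The covector at `x` determined by an operation `F` from vector fields to numbers which is
tensorial at `x`: it sends `Z x` to `F Z` (see `covectorAt_apply`). -/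
def covectorAt (F : VecField E M → ℝ) (x : M) : TangentSpace 𝓘(ℝ, E) x →L[ℝ] ℝ :=
  if h : TensorialAt 𝓘(ℝ, E) E F x then TensorialAt.mkHom F x h else 0

theorem covectorAt_apply {F : VecField E M → ℝ} {x : M} (h : TensorialAt 𝓘(ℝ, E) E F x)
    {Z : VecField E M}
    (hZ : MDifferentiableAt 𝓘(ℝ, E) (𝓘(ℝ, E).prod 𝓘(ℝ, E))
      (fun y => (TotalSpace.mk' E y (Z y) : TangentBundle 𝓘(ℝ, E) M)) x) :
    covectorAt F x (Z x) = F Z := by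
  rw [covectorAt, dif_pos h]
  exact h.mkHom_apply hZ

/-- The Lie derivative `L_X β` of a 1-form: `(L_X β)(Z) = X (β(Z)) - β([X, Z])`
(see `lieDeriv_apply`). -/
def lieDeriv (X : VecField E M) (β : OneForm E M) : OneForm E M :=
  fun x => covectorAt
    (fun Z => dirDeriv X (fun y => β y (Z y)) x - β x (lie X Z x)) x

theorem SmoothFormOn.mdifferentiableAt_apply {β : OneForm E M} {U : Set M} (hU : IsOpen U)
    (hβ : SmoothFormOn β U) {x : M} (hx : x ∈ U) {Z : VecField E M}
    (hZ : MDifferentiableAt 𝓘(ℝ, E) (𝓘(ℝ, E).prod 𝓘(ℝ, E))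
      (fun y => (TotalSpace.mk' E y (Z y) : TangentBundle 𝓘(ℝ, E) M)) x) :
    MDifferentiableAt 𝓘(ℝ, E) 𝓘(ℝ, ℝ) (fun y => β y (Z y)) x := by
  have h1 := ((hβ.contMDiffAt (hU.mem_nhds hx)).mdifferentiableAt (by simp))
  have h2 := MDifferentiableAt.clm_bundle_apply h1 hZ
  rw [mdifferentiableAt_totalSpace] at h2
  exact h2.2

theorem tensorialAt_lieDeriv {X : VecField E M} {β : OneForm E M} {U : Set M} (hU : IsOpen U)
    (hβ : SmoothFormOn β U) {x : M} (hx : x ∈ U) :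
    TensorialAt 𝓘(ℝ, E) E
      (fun Z : VecField E M => dirDeriv X (fun y => β y (Z y)) x - β x (lie X Z x)) x where
  smul := by
    intro f Z hf hZ
    have hd := hβ.mdifferentiableAt_apply hU hx hZ
    have e : (fun y => β y ((f • Z) y)) = f * (fun y => β y (Z y)) := by
      funext y; simp
    simp only [dirDeriv, lie]
    rw [e, mvfderiv_mul hf hd, VectorField.mlieBracket_smul_right hf hZ]
    simp
    ring
  add := by
    intro Z W hZ hW
    have hd := hβ.mdifferentiableAt_apply hU hx hZ
    have hd' := hβ.mdifferentiableAt_apply hU hx hW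
    have e : (fun y => β y ((Z + W) y)) = (fun y => β y (Z y)) + (fun y => β y (W y)) := by
      funext y; simp
    simp only [dirDeriv, lie]
    rw [e, mvfderiv_add hd hd', VectorField.mlieBracket_add_right hZ hW]
    simp
    ring

theorem lieDeriv_apply {X : VecField E M} {β : OneForm E M} {U : Set M} (hU : IsOpen U)
    (hβ : SmoothFormOn β U) {x : M} (hx : x ∈ U) {Z : VecField E M}
    (hZ : MDifferentiableAt 𝓘(ℝ, E) (𝓘(ℝ, E).prod 𝓘(ℝ, E))
      (fun y => (TotalSpace.mk' E y (Z y) : TangentBundle 𝓘(ℝ, E) M)) x) :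
    lieDeriv X β x (Z x) = dirDeriv X (fun y => β y (Z y)) x - β x (lie X Z x) :=
  covectorAt_apply (tensorialAt_lieDeriv hU hβ hx) hZ

/-- The exterior derivative of a 1-form evaluated on vector fields. -/
def extDerivOne (β : OneForm E M) (X Y : VecField E M) (x : M) : ℝ :=
  dirDeriv X (fun y => β y (Y y)) x - dirDeriv Y (fun y => β y (X y)) x - β x (lie X Y x)

/-- The exterior derivative of a 2-form evaluated on vector fields. -/
def extDerivTwo (s : Π x : M, TangentSpace 𝓘(ℝ, E) x → TangentSpace 𝓘(ℝ, E) x → ℝ)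
    (X Y Z : VecField E M) (x : M) : ℝ :=
  dirDeriv X (fun y => s y (Y y) (Z y)) x
    + dirDeriv Y (fun y => s y (Z y) (X y)) x
    + dirDeriv Z (fun y => s y (X y) (Y y)) x
    - s x (lie X Y x) (Z x) - s x (lie Y Z x) (X x) - s x (lie Z X x) (Y x)

/-- The 1-form `i(X ∧ Y) ds`, that is `Z ↦ ds(X, Y, Z)` (see `contractExtDerivTwo_apply`). -/
def contractExtDerivTwo (s : Π x : M, TangentSpace 𝓘(ℝ, E) x → TangentSpace 𝓘(ℝ, E) x → ℝ)
    (X Y : VecField E M) : OneForm E M :=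
  fun x => covectorAt (fun Z => extDerivTwo s X Y Z x) x

theorem contractExtDerivTwo_apply
    {σ : Π x : M, TangentSpace 𝓘(ℝ, E) x →ₗ[ℝ] (TangentSpace 𝓘(ℝ, E) x →L[ℝ] ℝ)}
    (hσ : ∀ x u v, σ x u v = -σ x v u) {X Y : VecField E M} {U : Set M} (hU : IsOpen U)
    (hX : SmoothFormOn (fun y => σ y (X y)) U) (hY : SmoothFormOn (fun y => σ y (Y y)) U)
    (hX' : SmoothVecOn X U) (hY' : SmoothVecOn Y U) {x : M} (hx : x ∈ U) {Z : VecField E M}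
    (hZ : MDifferentiableAt 𝓘(ℝ, E) (𝓘(ℝ, E).prod 𝓘(ℝ, E))
      (fun y => (TotalSpace.mk' E y (Z y) : TangentBundle 𝓘(ℝ, E) M)) x) :
    contractExtDerivTwo (fun y u v => σ y u v) X Y x (Z x)
      = extDerivTwo (fun y u v => σ y u v) X Y Z x := by
  have hXd := (hX'.contMDiffAt (hU.mem_nhds hx)).mdifferentiableAt (by simp)
  have hYd := (hY'.contMDiffAt (hU.mem_nhds hx)).mdifferentiableAt (by simp)
  refine covectorAt_apply ⟨?_, ?_⟩ hZ
  · intro f Z hf hZ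
    have h1 := hX.mdifferentiableAt_apply hU hx hZ
    have h2 := hY.mdifferentiableAt_apply hU hx hZ
    have e1 : (fun y => σ y (Y y) ((f • Z) y)) = f * (fun y => σ y (Y y) (Z y)) := by
      funext y; simp
    have e2 : (fun y => σ y ((f • Z) y) (X y)) = f * (fun y => σ y (Z y) (X y)) := by
      funext y; simp
    have h1' : MDifferentiableAt 𝓘(ℝ, E) 𝓘(ℝ, ℝ) (fun y => σ y (Z y) (X y)) x := by
      have e : (fun y => σ y (Z y) (X y)) = -(fun y => σ y (X y) (Z y)) := by
        funext y; simp [hσ y (Z y)]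
      rw [e]; exact h1.neg
    simp only [extDerivTwo, dirDeriv, lie]
    rw [e1, e2, mvfderiv_mul hf h2, mvfderiv_mul hf h1',
      VectorField.mlieBracket_smul_right hf hZ, VectorField.mlieBracket_smul_left hf hZ]
    simp
    rw [hσ x (Y x) (Z x)]
    ring
  · intro Z W hZ hW
    have sk : ∀ V : VecField E M, (fun y => σ y (V y) (X y)) = -(fun y => σ y (X y) (V y)) := by
      intro V; funext y; simp [hσ y (V y)]
    have h1 : MDifferentiableAt 𝓘(ℝ, E) 𝓘(ℝ, ℝ) (fun y => σ y (Z y) (X y)) x := by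
      rw [sk]; exact (hX.mdifferentiableAt_apply hU hx hZ).neg
    have h2 : MDifferentiableAt 𝓘(ℝ, E) 𝓘(ℝ, ℝ) (fun y => σ y (W y) (X y)) x := by
      rw [sk]; exact (hX.mdifferentiableAt_apply hU hx hW).neg
    have e1 : (fun y => σ y (Y y) ((Z + W) y))
        = (fun y => σ y (Y y) (Z y)) + (fun y => σ y (Y y) (W y)) := by
      funext y; simp
    have e2 : (fun y => σ y ((Z + W) y) (X y))
        = (fun y => σ y (Z y) (X y)) + (fun y => σ y (W y) (X y)) := by
      funext y; simp
    simp only [extDerivTwo, dirDeriv, lie]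
    rw [e1, e2, mvfderiv_add (hY.mdifferentiableAt_apply hU hx hZ)
        (hY.mdifferentiableAt_apply hU hx hW), mvfderiv_add h1 h2,
      VectorField.mlieBracket_add_right hZ hW, VectorField.mlieBracket_add_left hZ hW]
    simp
    ring

/-- The Courant bracket
`[(X, α), (Y, β)] = ([X, Y], L_X β - L_Y α + (1/2) d(α(Y) - β(X)))`. -/
def courant (ξ η : BigField E M) : BigField E M :=
  fun x =>
    (lie (fun y => (ξ y).1) (fun y => (η y).1) x,
      lieDeriv (fun y => (ξ y).1) (fun y => (η y).2) x
        - lieDeriv (fun y => (η y).1) (fun y => (ξ y).2) x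
        + (1 / 2 : ℝ) • diff (fun y => (ξ y).2 (η y).1 - (η y).2 (ξ y).1) x)

/-- The Courant-Nijenhuis torsion of a family of endomorphisms of the big tangent bundle. -/
def nijenhuisBig (Φ : BigEnd E M) (ξ η : BigField E M) : BigField E M :=
  fun x =>
    courant (fun y => Φ y (ξ y)) (fun y => Φ y (η y)) x
      - Φ x (courant ξ (fun y => Φ y (η y)) x)
      - Φ x (courant (fun y => Φ y (ξ y)) η x)
      + Φ x (Φ x (courant ξ η x))

/-- The Nijenhuis tensor of a field of endomorphisms of the tangent bundle. -/
def nijenhuis (A : Π x : M, TangentSpace 𝓘(ℝ, E) x →ₗ[ℝ] TangentSpace 𝓘(ℝ, E) x)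
    (X Y : VecField E M) : VecField E M :=
  fun x =>
    lie (fun y => A y (X y)) (fun y => A y (Y y)) x
      - A x (lie X (fun y => A y (Y y)) x)
      - A x (lie (fun y => A y (X y)) Y x)
      + A x (A x (lie X Y x))

/-- The Lie derivative `(L_V A)(X) = [V, A X] - A [V, X]` of a field of endomorphisms. -/
def lieDerivEnd (V : VecField E M)
    (A : Π x : M, TangentSpace 𝓘(ℝ, E) x →ₗ[ℝ] TangentSpace 𝓘(ℝ, E) x)
    (X : VecField E M) : VecField E M :=
  fun x => lie V (fun y => A y (X y)) x - A x (lie V X x)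

/-- The Schouten-Nijenhuis bracket of two bivector fields, given by their maps
`P, Q : T^*M → TM` (so that the bivector is `P(α, β) = β(P α)`), evaluated on 1-forms:
`[P, Q](α, β, γ) = - Σ_cycl ((L_{P α} β)(Q γ) + (L_{Q α} β)(P γ))`.
The sign is the one for which
`[X₁ ∧ X₂, Y₁ ∧ Y₂] = - Σ_{i,j} (-1)^(i+j) [X_i, Y_j] ∧ X_{3-i} ∧ Y_{3-j}`; equivalently
`[P, P](df, dg, dh) = 2 Σ_cycl {{f, g}, h}` with `{f, g} = P(df, dg)`. -/
def schouten
    (P Q : Π x : M, (TangentSpace 𝓘(ℝ, E) x →L[ℝ] ℝ) →ₗ[ℝ] TangentSpace 𝓘(ℝ, E) x)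
    (α β γ : OneForm E M) (x : M) : ℝ :=
  -((lieDeriv (fun y => P y (α y)) β x (Q x (γ x))
        + lieDeriv (fun y => Q y (α y)) β x (P x (γ x)))
      + (lieDeriv (fun y => P y (β y)) γ x (Q x (α x))
        + lieDeriv (fun y => Q y (β y)) γ x (P x (α x)))
      + (lieDeriv (fun y => P y (γ y)) α x (Q x (β x))
        + lieDeriv (fun y => Q y (γ y)) α x (P x (β x))))

/-- The wedge product of a 1-form and a 2-form at a point, evaluated on three vectors. -/
def wedgeOneTwo {x : M} (a : TangentSpace 𝓘(ℝ, E) x → ℝ)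
    (s : TangentSpace 𝓘(ℝ, E) x → TangentSpace 𝓘(ℝ, E) x → ℝ)
    (u v w : TangentSpace 𝓘(ℝ, E) x) : ℝ :=
  a u * s v w + a v * s w u + a w * s u v

/-- The wedge product of a vector and a bivector (given by `P`, with `P(α, β) = β(P α)`) at a
point, evaluated on three covectors. -/
def wedgeVecBivec {x : M} (v : TangentSpace 𝓘(ℝ, E) x)
    (P : (TangentSpace 𝓘(ℝ, E) x →L[ℝ] ℝ) →ₗ[ℝ] TangentSpace 𝓘(ℝ, E) x)
    (α β γ : TangentSpace 𝓘(ℝ, E) x →L[ℝ] ℝ) : ℝ :=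
  α v * γ (P β) + β v * α (P γ) + γ v * β (P α)

/-- The 1-form `ϖ` is closed. -/
def IsClosedForm (ϖ : OneForm E M) : Prop :=
  ∀ U : Set M, IsOpen U → ∀ X Y : VecField E M, SmoothVecOn X U → SmoothVecOn Y U →
    ∀ x ∈ U, extDerivOne ϖ X Y x = 0

/-- The 1-form `ϖ` is exact. -/
def IsExactForm (ϖ : OneForm E M) : Prop :=
  ∃ τ : M → ℝ, ContMDiff 𝓘(ℝ, E) 𝓘(ℝ, ℝ) ∞ τ ∧ ϖ = diff τ

end Calculus

section Structures

variable {E : Type*} [NormedAddCommGroup E] [NormedSpace ℝ E] [FiniteDimensional ℝ E]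
  {M : Type*} [TopologicalSpace M] [ChartedSpace E M] [IsManifold 𝓘(ℝ, E) ∞ M]

/-- The neutral metric `g((X, α), (Y, β)) = (1/2) (α(Y) + β(X))`. -/
def neutral {x : M} (ξ η : BigFiber E x) : ℝ :=
  (1 / 2) * (ξ.2 η.1 + η.2 ξ.1)

variable (E M) in
/-- A generalized almost complex structure: a smooth endomorphism `Φ` of the big tangent bundle
with `Φ² = -Id` which is skew for the neutral metric. Smoothness of the fibrewise linear map `Φ`
means that it carries smooth local sections to smooth local sections. -/
structure GenAlmostComplex where
  toEnd : BigEnd E M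
  smooth : ∀ U : Set M, IsOpen U → ∀ ξ : BigField E M, SmoothBigOn ξ U →
    SmoothBigOn (fun x => toEnd x (ξ x)) U
  sq : ∀ (x : M) (ξ : BigFiber E x), toEnd x (toEnd x ξ) = -ξ
  skew : ∀ (x : M) (ξ η : BigFiber E x),
    neutral ξ (toEnd x η) + neutral (toEnd x ξ) η = 0

/-- The conformal change `C_τ(X, α) = (X, e^τ α)`. -/
def conformal (τ : M → ℝ) : BigEnd E M :=
  fun x => LinearMap.prodMap LinearMap.id (Real.exp (τ x) • LinearMap.id)

/-- The transformed endomorphism `Φ' = C_{-τ} ∘ Φ ∘ C_τ`. -/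
def conformalConj (τ : M → ℝ) (Φ : BigEnd E M) : BigEnd E M :=
  fun x => conformal (fun y => -τ y) x ∘ₗ Φ x ∘ₗ conformal τ x

/-- `Φ` is integrable on the open set `U`: its Nijenhuis torsion with respect to the Courant
bracket vanishes on all local smooth sections over open subsets of `U`. -/
def IntegrableOn (Φ : BigEnd E M) (U : Set M) : Prop :=
  ∀ V : Set M, IsOpen V → V ⊆ U → ∀ ξ η : BigField E M, SmoothBigOn ξ V → SmoothBigOn η V →
    ∀ x ∈ V, nijenhuisBig Φ ξ η x = 0

/-- `Φ` is globally conformal integrable. -/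
def GloballyConformalIntegrable (Φ : GenAlmostComplex E M) : Prop :=
  ∃ τ : M → ℝ, ContMDiff 𝓘(ℝ, E) 𝓘(ℝ, ℝ) ∞ τ ∧
    IntegrableOn (conformalConj τ Φ.toEnd) Set.univ

/-- `Φ` is locally conformal integrable: near each point there is a conformal change with a
smooth local function `τ` on a neighbourhood `U` which makes `Φ` integrable on `U`. -/
def LocallyConformalIntegrable (Φ : GenAlmostComplex E M) : Prop :=
  ∀ x : M, ∃ U : Set M, IsOpen U ∧ x ∈ U ∧ ∃ τ : M → ℝ,
    ContMDiffOn 𝓘(ℝ, E) 𝓘(ℝ, ℝ) ∞ τ U ∧ IntegrableOn (conformalConj τ Φ.toEnd) U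

namespace GenAlmostComplex

/-- The endomorphism `A` of the tangent bundle, in
`Φ(X, α) = (A X + ♯_π α, ♭_σ X - α ∘ A)`. -/
def A (Φ : GenAlmostComplex E M) (x : M) :
    TangentSpace 𝓘(ℝ, E) x →ₗ[ℝ] TangentSpace 𝓘(ℝ, E) x :=
  LinearMap.fst ℝ _ _ ∘ₗ Φ.toEnd x ∘ₗ LinearMap.inl ℝ _ _

/-- The map `♯_π`; the bivector field is `π(α, β) = β(♯_π α)`. -/
def sharp (Φ : GenAlmostComplex E M) (x : M) :
    (TangentSpace 𝓘(ℝ, E) x →L[ℝ] ℝ) →ₗ[ℝ] TangentSpace 𝓘(ℝ, E) x :=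
  LinearMap.fst ℝ _ _ ∘ₗ Φ.toEnd x ∘ₗ LinearMap.inr ℝ _ _

/-- The map `♭_σ`. -/
def flat (Φ : GenAlmostComplex E M) (x : M) :
    TangentSpace 𝓘(ℝ, E) x →ₗ[ℝ] (TangentSpace 𝓘(ℝ, E) x →L[ℝ] ℝ) :=
  LinearMap.snd ℝ _ _ ∘ₗ Φ.toEnd x ∘ₗ LinearMap.inl ℝ _ _

/-- The 2-form `σ`, with `♭_σ X = σ(X, ·)`. -/
def sigma (Φ : GenAlmostComplex E M) (x : M) (u v : TangentSpace 𝓘(ℝ, E) x) : ℝ :=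
  Φ.flat x u v

/-- The associated 2-form `σ_A(X, Y) = σ(A X, Y)`. -/
def sigmaA (Φ : GenAlmostComplex E M) (x : M) (u v : TangentSpace 𝓘(ℝ, E) x) : ℝ :=
  Φ.sigma x (Φ.A x u) v

/-- The Schouten concomitant
`R(α, X) = ♯_π (L_X (α ∘ A) - L_{A X} α) - (L_{♯_π α} A)(X)`. -/
def concomitant (Φ : GenAlmostComplex E M) (α : OneForm E M) (X : VecField E M) :
    VecField E M :=
  fun x =>
    Φ.sharp x
      (lieDeriv X (fun y => covComp (α y) (Φ.A y)) x
        - lieDeriv (fun y => Φ.A y (X y)) α x)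
      - lieDerivEnd (fun y => Φ.sharp y (α y)) Φ.A X x

/-- The bivector field `π` is non degenerate at `x`. -/
def PiNondegAt (Φ : GenAlmostComplex E M) (x : M) : Prop :=
  Function.Bijective (Φ.sharp x)

/-- The 2-form `σ` is non degenerate at `x`. -/
def SigmaNondegAt (Φ : GenAlmostComplex E M) (x : M) : Prop :=
  Function.Bijective (Φ.flat x)

/-- The rank of the bivector field `π` at `x`. -/
def rankPi (Φ : GenAlmostComplex E M) (x : M) : ℕ :=
  Module.finrank ℝ (LinearMap.range (Φ.sharp x))

end GenAlmostComplex

/-- The four tensorial conditions relating `Φ`, with classical tensor fields `(A, π, σ)`, and a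
1-form `ϖ`. -/
structure LeeConditions (Φ : GenAlmostComplex E M) (ϖ : OneForm E M) : Prop where
  /-- `[π, π] = -2 (♯_π ϖ) ∧ π`. -/
  poisson : ∀ U : Set M, IsOpen U → ∀ α β γ : OneForm E M,
    SmoothFormOn α U → SmoothFormOn β U → SmoothFormOn γ U → ∀ x ∈ U,
      schouten Φ.sharp Φ.sharp α β γ x
        = -2 * wedgeVecBivec (Φ.sharp x (ϖ x)) (Φ.sharp x) (α x) (β x) (γ x)
  /-- `R(α, X) = ϖ(X) A ♯_π α - ϖ(A X) ♯_π α`. -/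
  concomitant : ∀ U : Set M, IsOpen U → ∀ (α : OneForm E M) (X : VecField E M),
    SmoothFormOn α U → SmoothVecOn X U → ∀ x ∈ U,
      Φ.concomitant α X x
        = ϖ x (X x) • Φ.A x (Φ.sharp x (α x)) - ϖ x (Φ.A x (X x)) • Φ.sharp x (α x)
  /-- `N_A(X, Y) - ♯_π [i(X ∧ Y) dσ]
  = -σ(X, Y) ♯_π ϖ + ϖ(X) (Id + A²) Y - ϖ(Y) (Id + A²) X`. -/
  nijenhuis : ∀ U : Set M, IsOpen U → ∀ X Y : VecField E M,
    SmoothVecOn X U → SmoothVecOn Y U → ∀ x ∈ U,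
      GenCx.nijenhuis Φ.A X Y x - Φ.sharp x (contractExtDerivTwo Φ.sigma X Y x)
        = -(Φ.sigma x (X x) (Y x) • Φ.sharp x (ϖ x))
          + ϖ x (X x) • (Y x + Φ.A x (Φ.A x (Y x)))
          - ϖ x (Y x) • (X x + Φ.A x (Φ.A x (X x)))
  /-- `dσ_A(X, Y, Z) - Σ_cycl dσ(A X, Y, Z) = -[ϖ ∧ σ_A + (ϖ ∘ A) ∧ σ](X, Y, Z)`. -/
  associated : ∀ U : Set M, IsOpen U → ∀ X Y Z : VecField E M,
    SmoothVecOn X U → SmoothVecOn Y U → SmoothVecOn Z U → ∀ x ∈ U,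
      extDerivTwo Φ.sigmaA X Y Z x
          - (extDerivTwo Φ.sigma (fun y => Φ.A y (X y)) Y Z x
            + extDerivTwo Φ.sigma (fun y => Φ.A y (Y y)) Z X x
            + extDerivTwo Φ.sigma (fun y => Φ.A y (Z y)) X Y x)
        = -(wedgeOneTwo (fun v => ϖ x v) (Φ.sigmaA x) (X x) (Y x) (Z x)
            + wedgeOneTwo (fun v => ϖ x (Φ.A x v)) (Φ.sigma x) (X x) (Y x) (Z x))

end Structures

end GenCx

end

/-! Everything reduces to a condition at each point. `LeeAt A P S x κ` says that the four equations
(i)-(iv) hold at `x` with a single covector `κ` in place of the Lee form, so that `κ = 0` is the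
case where all right-hand sides vanish.

Paired with the neutral metric, the Courant torsion is a combination of Dorfman pairings
(`neutral_nijenhuisBig`) and is skew in all three arguments (`nijenhuisBig_swap_left`,
`nijenhuisBig_swap_right`). It therefore vanishes exactly when its components on pure vectors and
pure covectors do. Up to constants these are the Schouten bracket, the concomitant, and the left
sides of (iii) and (iv), so vanishing torsion means `LeeAt` with `κ = 0`
(`nijenhuisBig_eq_zero_iff_leeAt_zero`).

A conformal change replaces (A, π, σ) by (A, e^τ π, e^{-τ} σ). The Leibniz rule then adds to the
four expressions precisely the right-hand sides belonging to dτ (`leeAt_conformal_iff`). Hence the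
change by τ is integrable on U if and only if dτ satisfies the four equations on U
(`integrableOn_conformalConj_iff`).

The nondegeneracy hypotheses make `κ` unique (`LeeNondegAt.leeAt_unique`). So the local
differentials dτ agree on overlaps and glue to a closed form; conversely the Poincaré lemma
(`IsClosedForm.exists_eq_diff`) supplies local functions τ. By the same uniqueness a global τ has dτ
equal to any given Lee form, which is the statement about exactness. -/

noncomputable section

set_option linter.unusedSectionVars false

namespace GenCx

open Bundle Set

/-! ### Smooth local sections and rules for derivatives and brackets. -/

section Basic

variable {E : Type*} [NormedAddCommGroup E] [NormedSpace ℝ E] [FiniteDimensional ℝ E]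
  {M : Type*} [TopologicalSpace M] [ChartedSpace E M] [IsManifold 𝓘(ℝ, E) ∞ M]

theorem SmoothVecOn.mono {X : VecField E M} {U V : Set M} (h : SmoothVecOn X U) (hV : V ⊆ U) :
    SmoothVecOn X V := ContMDiffOn.mono h hV

theorem SmoothFormOn.mono {α : OneForm E M} {U V : Set M} (h : SmoothFormOn α U) (hV : V ⊆ U) :
    SmoothFormOn α V := ContMDiffOn.mono h hV

theorem SmoothBigOn.mono {ξ : BigField E M} {U V : Set M} (h : SmoothBigOn ξ U) (hV : V ⊆ U) :
    SmoothBigOn ξ V := ⟨h.1.mono hV, h.2.mono hV⟩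

theorem smoothVecOn_zero (U : Set M) : SmoothVecOn (fun _ => 0 : VecField E M) U :=
  (contMDiff_zeroSection ℝ (TangentSpace 𝓘(ℝ, E) : M → Type _)).contMDiffOn

theorem smoothFormOn_zero (U : Set M) : SmoothFormOn (fun _ => 0 : OneForm E M) U :=
  (contMDiff_zeroSection ℝ
    (fun y : M => TangentSpace 𝓘(ℝ, E) y →L[ℝ] Bundle.Trivial M ℝ y)).contMDiffOn

theorem SmoothVecOn.smul {X : VecField E M} {U : Set M} (h : SmoothVecOn X U) {f : M → ℝ}
    (hf : ContMDiffOn 𝓘(ℝ, E) 𝓘(ℝ, ℝ) ∞ f U) : SmoothVecOn (fun y => f y • X y) U :=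
  ContMDiffOn.smul_section hf h

theorem SmoothFormOn.smul {α : OneForm E M} {U : Set M} (h : SmoothFormOn α U) {f : M → ℝ}
    (hf : ContMDiffOn 𝓘(ℝ, E) 𝓘(ℝ, ℝ) ∞ f U) : SmoothFormOn (fun y => f y • α y) U :=
  ContMDiffOn.smul_section
    (V := fun y : M => TangentSpace 𝓘(ℝ, E) y →L[ℝ] Bundle.Trivial M ℝ y) hf h

theorem SmoothVecOn.add {X Y : VecField E M} {U : Set M} (h : SmoothVecOn X U)
    (h' : SmoothVecOn Y U) : SmoothVecOn (fun y => X y + Y y) U :=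
  ContMDiffOn.add_section h h'

theorem SmoothFormOn.sub {α β : OneForm E M} {U : Set M} (h : SmoothFormOn α U)
    (h' : SmoothFormOn β U) : SmoothFormOn (fun y => α y - β y) U :=
  ContMDiffOn.sub_section
    (V := fun y : M => TangentSpace 𝓘(ℝ, E) y →L[ℝ] Bundle.Trivial M ℝ y) h h'

theorem SmoothVecOn.mdiffAt {X : VecField E M} {U : Set M} (hU : IsOpen U) (h : SmoothVecOn X U)
    {x : M} (hx : x ∈ U) : MDifferentiableAt 𝓘(ℝ, E) (𝓘(ℝ, E).prod 𝓘(ℝ, E))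
      (fun y => (TotalSpace.mk' E y (X y) : TangentBundle 𝓘(ℝ, E) M)) x :=
  (ContMDiffOn.contMDiffAt h (hU.mem_nhds hx)).mdifferentiableAt (by simp)

theorem SmoothFormOn.apply {β : OneForm E M} {Z : VecField E M} {U : Set M}
    (hβ : SmoothFormOn β U) (hZ : SmoothVecOn Z U) :
    ContMDiffOn 𝓘(ℝ, E) 𝓘(ℝ, ℝ) ∞ (fun y => β y (Z y)) U := by
  intro x hx
  have := ContMDiffWithinAt.clm_bundle_apply (hβ x hx) (hZ x hx)
  rw [contMDiffWithinAt_totalSpace] at this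
  exact this.2

theorem SmoothFormOn.mdiffAt_apply {β : OneForm E M} {Z : VecField E M} {U : Set M}
    (hU : IsOpen U) (hβ : SmoothFormOn β U) (hZ : SmoothVecOn Z U) {x : M} (hx : x ∈ U) :
    MDifferentiableAt 𝓘(ℝ, E) 𝓘(ℝ, ℝ) (fun y => β y (Z y)) x :=
  hβ.mdifferentiableAt_apply hU hx (hZ.mdiffAt hU hx)

/-- Every tangent vector extends to a vector field that is smooth near its base point. -/
theorem exists_smoothVecOn (x : M) (v : TangentSpace 𝓘(ℝ, E) x) :
    ∃ U : Set M, IsOpen U ∧ x ∈ U ∧ ∃ X : VecField E M, SmoothVecOn X U ∧ X x = v := by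
  obtain ⟨s, hs, h⟩ := FiberBundle.exists_contMDiffOn_extend (k := ∞) 𝓘(ℝ, E) E v
  obtain ⟨U, hUs, hU, hxU⟩ := mem_nhds_iff.1 hs
  exact ⟨U, hU, hxU, _, ContMDiffOn.mono h hUs, FiberBundle.extend_apply_self E v⟩

/-- Every covector extends to a 1-form that is smooth near its base point. -/
theorem exists_smoothFormOn (x : M) (v : TangentSpace 𝓘(ℝ, E) x →L[ℝ] ℝ) :
    ∃ U : Set M, IsOpen U ∧ x ∈ U ∧ ∃ α : OneForm E M, SmoothFormOn α U ∧ α x = v := by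
  obtain ⟨s, hs, h⟩ := FiberBundle.exists_contMDiffOn_extend (k := ∞) 𝓘(ℝ, E) (E →L[ℝ] ℝ)
    (V := fun y : M => TangentSpace 𝓘(ℝ, E) y →L[ℝ] Bundle.Trivial M ℝ y) v
  obtain ⟨U, hUs, hU, hxU⟩ := mem_nhds_iff.1 hs
  exact ⟨U, hU, hxU, _, ContMDiffOn.mono h hUs, FiberBundle.extend_apply_self (E →L[ℝ] ℝ)
    (E := fun y : M => TangentSpace 𝓘(ℝ, E) y →L[ℝ] Bundle.Trivial M ℝ y) v⟩

theorem dirDeriv_add (X : VecField E M) {f g : M → ℝ} {x : M}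
    (hf : MDifferentiableAt 𝓘(ℝ, E) 𝓘(ℝ, ℝ) f x) (hg : MDifferentiableAt 𝓘(ℝ, E) 𝓘(ℝ, ℝ) g x) :
    dirDeriv X (fun y => f y + g y) x = dirDeriv X f x + dirDeriv X g x := by
  have := mvfderiv_add hf hg
  simp only [dirDeriv]
  exact congrArg (fun L => L (X x)) this

theorem dirDeriv_neg (X : VecField E M) (f : M → ℝ) (x : M) :
    dirDeriv X (fun y => - f y) x = - dirDeriv X f x :=
  congrArg (fun L => L (X x)) (mvfderiv_neg (I := 𝓘(ℝ, E)) (g := f) (x := x))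

theorem dirDeriv_mul (X : VecField E M) {f g : M → ℝ} {x : M}
    (hf : MDifferentiableAt 𝓘(ℝ, E) 𝓘(ℝ, ℝ) f x) (hg : MDifferentiableAt 𝓘(ℝ, E) 𝓘(ℝ, ℝ) g x) :
    dirDeriv X (fun y => f y * g y) x = f x * dirDeriv X g x + g x * dirDeriv X f x := by
  have : dirDeriv X (fun y => f y * g y) x = dirDeriv X (f * g) x := rfl
  rw [this]
  simp [dirDeriv, mvfderiv_mul hf hg]

@[simp] theorem dirDeriv_const (X : VecField E M) (c : ℝ) (x : M) :
    dirDeriv X (fun _ => c) x = 0 := by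
  simp [dirDeriv, mvfderiv_const]

@[simp] theorem dirDeriv_zero_field (f : M → ℝ) (x : M) :
    dirDeriv (fun _ => 0 : VecField E M) f x = 0 := by
  simp [dirDeriv]

theorem diff_apply (f : M → ℝ) (X : VecField E M) (x : M) :
    diff f x (X x) = dirDeriv X f x := rfl

theorem diff_sub {f g : M → ℝ} {x : M}
    (hf : MDifferentiableAt 𝓘(ℝ, E) 𝓘(ℝ, ℝ) f x) (hg : MDifferentiableAt 𝓘(ℝ, E) 𝓘(ℝ, ℝ) g x) :
    (diff (fun y => f y - g y) x : TangentSpace 𝓘(ℝ, E) x →L[ℝ] ℝ) = diff f x - diff g x :=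
  mvfderiv_sub hf hg

theorem lie_swap (X Y : VecField E M) (x : M) : lie X Y x = - lie Y X x :=
  VectorField.mlieBracket_swap_apply

@[simp] theorem lie_zero_left (Y : VecField E M) (x : M) : lie (fun _ => 0) Y x = 0 :=
  congrFun (VectorField.mlieBracket_zero_left (W := Y)) x

@[simp] theorem lie_zero_right (Y : VecField E M) (x : M) : lie Y (fun _ => 0) x = 0 :=
  congrFun (VectorField.mlieBracket_zero_right (W := Y)) x

theorem lie_smul_left {X : VecField E M} (Y : VecField E M) {f : M → ℝ} {U : Set M}
    (hU : IsOpen U) (hX : SmoothVecOn X U) {x : M} (hx : x ∈ U)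
    (hf : MDifferentiableAt 𝓘(ℝ, E) 𝓘(ℝ, ℝ) f x) :
    lie (fun y => f y • X y) Y x = - (dirDeriv Y f x • X x) + f x • lie X Y x := by
  have := VectorField.mlieBracket_smul_left (W := Y) hf (hX.mdiffAt hU hx)
  rw [neg_smul] at this
  exact this

theorem SmoothFormOn.lieDeriv_apply {X : VecField E M} {β : OneForm E M} {U : Set M}
    (hU : IsOpen U) (hβ : SmoothFormOn β U) {Z : VecField E M} (hZ : SmoothVecOn Z U)
    {x : M} (hx : x ∈ U) :
    lieDeriv X β x (Z x) = dirDeriv X (fun y => β y (Z y)) x - β x (lie X Z x) :=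
  GenCx.lieDeriv_apply hU hβ hx (hZ.mdiffAt hU hx)

/-- Two covectors which agree on the values of all local vector fields are equal. -/
theorem covector_ext {x : M} {a b : TangentSpace 𝓘(ℝ, E) x →L[ℝ] ℝ} {U : Set M} (hU : IsOpen U)
    (hx : x ∈ U) (h : ∀ V : Set M, IsOpen V → x ∈ V → V ⊆ U →
      ∀ Z : VecField E M, SmoothVecOn Z V → a (Z x) = b (Z x)) : a = b := by
  ext v
  obtain ⟨V, hV, hxV, Z, hZ, rfl⟩ := exists_smoothVecOn x v
  exact h (V ∩ U) (hV.inter hU) ⟨hxV, hx⟩ inter_subset_right Z (hZ.mono inter_subset_left)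

end Basic

/-! ### Generalized almost complex structures as triples (A, π, σ), and skew-symmetry of the
torsion. -/

section Torsion

variable {E : Type*} [NormedAddCommGroup E] [NormedSpace ℝ E] [FiniteDimensional ℝ E]
  {M : Type*} [TopologicalSpace M] [ChartedSpace E M] [IsManifold 𝓘(ℝ, E) ∞ M]

variable (E M) in
/-- Fields of endomorphisms of the tangent spaces. -/
abbrev EndField : Type _ := Π x : M, TangentSpace 𝓘(ℝ, E) x →ₗ[ℝ] TangentSpace 𝓘(ℝ, E) x

variable (E M) in
/-- Fields of linear maps from cotangent to tangent spaces. -/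
abbrev SharpField : Type _ :=
  Π x : M, (TangentSpace 𝓘(ℝ, E) x →L[ℝ] ℝ) →ₗ[ℝ] TangentSpace 𝓘(ℝ, E) x

variable (E M) in
/-- Fields of linear maps from tangent to cotangent spaces. -/
abbrev FlatField : Type _ :=
  Π x : M, TangentSpace 𝓘(ℝ, E) x →ₗ[ℝ] (TangentSpace 𝓘(ℝ, E) x →L[ℝ] ℝ)

@[simp] theorem covComp_apply {x : M} (α : TangentSpace 𝓘(ℝ, E) x →L[ℝ] ℝ)
    (A : TangentSpace 𝓘(ℝ, E) x →ₗ[ℝ] TangentSpace 𝓘(ℝ, E) x) (v : TangentSpace 𝓘(ℝ, E) x) :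
    covComp α A v = α (A v) := rfl

/-- The endomorphism `(X, α) ↦ (A X + P α, S X - α ∘ A)` of the big tangent bundle. -/
def ofTriple (A : EndField E M) (P : SharpField E M) (S : FlatField E M) : BigEnd E M := fun x =>
  { toFun := fun ξ => (A x ξ.1 + P x ξ.2, S x ξ.1 - covComp ξ.2 (A x))
    map_add' := by
      intro ξ η
      ext
      · simp only [Prod.fst_add, Prod.snd_add, map_add]; abel
      · simp; ring
    map_smul' := by
      intro c ξ
      ext
      · simp
      · simp; ring }

theorem ofTriple_apply (A : EndField E M) (P : SharpField E M) (S : FlatField E M) (x : M)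
    (ξ : BigFiber E x) :
    ofTriple A P S x ξ = (A x ξ.1 + P x ξ.2, S x ξ.1 - covComp ξ.2 (A x)) := rfl

/-- The classical tensor fields `(A, P, S)` form a generalized almost complex structure, which is
smooth on the open set `U`. -/
structure IsAlmostComplexTriple (A : EndField E M) (P : SharpField E M) (S : FlatField E M)
    (U : Set M) : Prop where
  sharp_skew : ∀ x (α β : TangentSpace 𝓘(ℝ, E) x →L[ℝ] ℝ), α (P x β) = - β (P x α)
  flat_skew : ∀ x (u v : TangentSpace 𝓘(ℝ, E) x), S x u v = - S x v u
  sq : ∀ x (u : TangentSpace 𝓘(ℝ, E) x), A x (A x u) + P x (S x u) = - u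
  end_sharp : ∀ x (α : TangentSpace 𝓘(ℝ, E) x →L[ℝ] ℝ), A x (P x α) = P x (covComp α (A x))
  flat_end : ∀ x (u v : TangentSpace 𝓘(ℝ, E) x), S x (A x u) v = S x u (A x v)
  smooth_end : ∀ V : Set M, IsOpen V → V ⊆ U → ∀ X : VecField E M, SmoothVecOn X V →
    SmoothVecOn (fun y => A y (X y)) V
  smooth_flat : ∀ V : Set M, IsOpen V → V ⊆ U → ∀ X : VecField E M, SmoothVecOn X V →
    SmoothFormOn (fun y => S y (X y)) V
  smooth_sharp : ∀ V : Set M, IsOpen V → V ⊆ U → ∀ α : OneForm E M, SmoothFormOn α V →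
    SmoothVecOn (fun y => P y (α y)) V
  smooth_comp : ∀ V : Set M, IsOpen V → V ⊆ U → ∀ α : OneForm E M, SmoothFormOn α V →
    SmoothFormOn (fun y => covComp (α y) (A y)) V

namespace IsAlmostComplexTriple

variable {A : EndField E M} {P : SharpField E M} {S : FlatField E M} {U : Set M}

/-- This is the transpose of `sq`: pair that identity with `α` and move `P` and `S` across by
skewness. It is the covector part of Φ² = -Id. -/
theorem flat_sharp (h : IsAlmostComplexTriple A P S U) (x : M)
    (α : TangentSpace 𝓘(ℝ, E) x →L[ℝ] ℝ) (v : TangentSpace 𝓘(ℝ, E) x) :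
    S x (P x α) v + α (A x (A x v)) = - α v := by
  have h1 := h.flat_skew x (P x α) v
  have h2 := h.sharp_skew x (S x v) α
  have h3 := congrArg α (h.sq x v)
  simp only [map_add, map_neg] at h3
  linarith

theorem smooth (h : IsAlmostComplexTriple A P S U) {V : Set M} (hV : IsOpen V) (hVU : V ⊆ U)
    {ξ : BigField E M} (hξ : SmoothBigOn ξ V) :
    SmoothBigOn (fun x => ofTriple A P S x (ξ x)) V :=
  ⟨(h.smooth_end V hV hVU _ hξ.1).add (h.smooth_sharp V hV hVU _ hξ.2),
    (h.smooth_flat V hV hVU _ hξ.1).sub (h.smooth_comp V hV hVU _ hξ.2)⟩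

theorem ofTriple_sq (h : IsAlmostComplexTriple A P S U) (x : M) (ξ : BigFiber E x) :
    ofTriple A P S x (ofTriple A P S x ξ) = - ξ := by
  ext v
  · simp only [ofTriple_apply, map_add, map_sub, Prod.fst_neg, ← h.sq x ξ.1, h.end_sharp]
    abel
  · have := h.flat_sharp x ξ.2 v
    have := h.flat_end x ξ.1 v
    simp [ofTriple_apply]
    linarith

theorem ofTriple_skew (h : IsAlmostComplexTriple A P S U) (x : M) (ξ η : BigFiber E x) :
    neutral (ofTriple A P S x ξ) η = - neutral ξ (ofTriple A P S x η) := by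
  have := h.sharp_skew x ξ.2 η.2
  have := h.flat_skew x ξ.1 η.1
  simp [ofTriple_apply, neutral]
  linarith

end IsAlmostComplexTriple

theorem neutral_add_left {x : M} (ξ ξ' η : BigFiber E x) :
    neutral (ξ + ξ') η = neutral ξ η + neutral ξ' η := by
  simp [neutral]; ring

theorem neutral_sub_left {x : M} (ξ ξ' η : BigFiber E x) :
    neutral (ξ - ξ') η = neutral ξ η - neutral ξ' η := by
  simp [neutral]; ring

theorem neutral_neg_left {x : M} (ξ η : BigFiber E x) : neutral (-ξ) η = - neutral ξ η := by
  simp [neutral]; ring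

theorem neutral_neg_right {x : M} (ξ η : BigFiber E x) : neutral ξ (-η) = - neutral ξ η := by
  simp [neutral]; ring

/-- The pairing `g([ξ, η], ζ)` for the Dorfman bracket. -/
def dorfmanPairing (ξ η ζ : BigField E M) (x : M) : ℝ :=
  (1 / 2) * (dirDeriv (fun y => (ξ y).1) (fun y => (η y).2 (ζ y).1) x
    - dirDeriv (fun y => (η y).1) (fun y => (ξ y).2 (ζ y).1) x
    + dirDeriv (fun y => (ζ y).1) (fun y => (ξ y).2 (η y).1) x
    - (η x).2 (lie (fun y => (ξ y).1) (fun y => (ζ y).1) x)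
    + (ξ x).2 (lie (fun y => (η y).1) (fun y => (ζ y).1) x)
    + (ζ x).2 (lie (fun y => (ξ y).1) (fun y => (η y).1) x))

theorem dirDeriv_neutral (X : VecField E M) {ξ η : BigField E M} {V : Set M} (hV : IsOpen V)
    (hξ : SmoothBigOn ξ V) (hη : SmoothBigOn η V) {x : M} (hx : x ∈ V) :
    dirDeriv X (fun y => neutral (ξ y) (η y)) x
      = (1 / 2) * (dirDeriv X (fun y => (ξ y).2 (η y).1) x
        + dirDeriv X (fun y => (η y).2 (ξ y).1) x) := by
  have h1 := hξ.2.mdiffAt_apply hV hη.1 hx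
  have h2 := hη.2.mdiffAt_apply hV hξ.1 hx
  simp only [neutral]
  rw [dirDeriv_mul X mdifferentiableAt_const
    (g := fun y => (ξ y).2 (η y).1 + (η y).2 (ξ y).1) (h1.add h2), dirDeriv_add X h1 h2]
  simp

/-- The Courant bracket is the Dorfman bracket minus (0, d g(ξ, η)). The Dorfman pairing is easier
to handle because its failure to be skew is a single derivative of the metric. -/
theorem neutral_courant {ξ η ζ : BigField E M} {V : Set M} (hV : IsOpen V)
    (hξ : SmoothBigOn ξ V) (hη : SmoothBigOn η V) (hζ : SmoothBigOn ζ V) {x : M} (hx : x ∈ V) :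
    neutral (courant ξ η x) (ζ x) = dorfmanPairing ξ η ζ x
      - (1 / 2) * dirDeriv (fun y => (ζ y).1) (fun y => neutral (ξ y) (η y)) x := by
  rw [dirDeriv_neutral _ hV hξ hη hx]
  have h1 := hξ.2.mdiffAt_apply hV hη.1 hx
  have h2 := hη.2.mdiffAt_apply hV hξ.1 hx
  simp only [neutral, courant, dorfmanPairing]
  rw [diff_sub h1 h2]
  simp only [add_apply, sub_apply,
    smul_apply, smul_eq_mul]
  rw [hη.2.lieDeriv_apply hV hζ.1 hx, hξ.2.lieDeriv_apply hV hζ.1 hx, diff_apply _ (fun y => (ζ y).1),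
    diff_apply _ (fun y => (ζ y).1)]
  ring

theorem dorfmanPairing_add_swap_right {ξ η ζ : BigField E M} {V : Set M} (hV : IsOpen V)
    (hη : SmoothBigOn η V) (hζ : SmoothBigOn ζ V) {x : M} (hx : x ∈ V) :
    dorfmanPairing ξ η ζ x + dorfmanPairing ξ ζ η x
      = dirDeriv (fun y => (ξ y).1) (fun y => neutral (η y) (ζ y)) x := by
  rw [dirDeriv_neutral _ hV hη hζ hx]
  simp only [dorfmanPairing]
  rw [lie_swap (fun y => (ζ y).1) (fun y => (η y).1)]
  simp only [map_neg]
  ring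

theorem dorfmanPairing_add_swap_left {ξ η ζ : BigField E M} {V : Set M} (hV : IsOpen V)
    (hξ : SmoothBigOn ξ V) (hη : SmoothBigOn η V) {x : M} (hx : x ∈ V) :
    dorfmanPairing ξ η ζ x + dorfmanPairing η ξ ζ x
      = dirDeriv (fun y => (ζ y).1) (fun y => neutral (ξ y) (η y)) x := by
  rw [dirDeriv_neutral _ hV hξ hη hx]
  simp only [dorfmanPairing]
  rw [lie_swap (fun y => (η y).1) (fun y => (ξ y).1)]
  simp only [map_neg]
  ring

variable {A : EndField E M} {P : SharpField E M} {S : FlatField E M} {U : Set M}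

/-- The metric corrections from `neutral_courant` cancel: g(Φξ, Φη) = g(ξ, η) disposes of the terms
differentiated along ζ, and g(ξ, Φη) + g(Φξ, η) = 0 of those along Φζ. The outer Φ in the torsion is
moved onto ζ by skewness. -/
theorem neutral_nijenhuisBig (h : IsAlmostComplexTriple A P S U) {ξ η ζ : BigField E M}
    {V : Set M} (hV : IsOpen V) (hVU : V ⊆ U) (hξ : SmoothBigOn ξ V) (hη : SmoothBigOn η V)
    (hζ : SmoothBigOn ζ V) {x : M} (hx : x ∈ V) :
    neutral (nijenhuisBig (ofTriple A P S) ξ η x) (ζ x)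
      = dorfmanPairing (fun y => ofTriple A P S y (ξ y)) (fun y => ofTriple A P S y (η y)) ζ x
        + dorfmanPairing ξ (fun y => ofTriple A P S y (η y)) (fun y => ofTriple A P S y (ζ y)) x
        + dorfmanPairing (fun y => ofTriple A P S y (ξ y)) η (fun y => ofTriple A P S y (ζ y)) x
        - dorfmanPairing ξ η ζ x := by
  have hξ' := h.smooth hV hVU hξ
  have hη' := h.smooth hV hVU hη
  have hζ' := h.smooth hV hVU hζ
  simp only [nijenhuisBig]
  rw [neutral_add_left, neutral_sub_left, neutral_sub_left, h.ofTriple_sq, h.ofTriple_skew,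
    h.ofTriple_skew, neutral_neg_left, neutral_courant hV hξ' hη' hζ hx,
    neutral_courant hV hξ hη' hζ' hx, neutral_courant hV hξ' hη hζ' hx,
    neutral_courant hV hξ hη hζ hx]
  simp only [h.ofTriple_skew, h.ofTriple_sq, neutral_neg_right, neg_neg]
  rw [dirDeriv_neg]
  ring

/-- Exchanging the last two arguments of a Dorfman pairing produces, up to sign, the derivative of
their metric product along the first. Over the four terms these derivatives cancel in pairs, since Φ
preserves g and is skew for it. The swap of the first two arguments works in the same way, with
derivatives along the third. -/
theorem nijenhuisBig_swap_right (h : IsAlmostComplexTriple A P S U) {ξ η ζ : BigField E M}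
    {V : Set M} (hV : IsOpen V) (hVU : V ⊆ U) (hξ : SmoothBigOn ξ V) (hη : SmoothBigOn η V)
    (hζ : SmoothBigOn ζ V) {x : M} (hx : x ∈ V) :
    neutral (nijenhuisBig (ofTriple A P S) ξ η x) (ζ x)
      = - neutral (nijenhuisBig (ofTriple A P S) ξ ζ x) (η x) := by
  have hξ' := h.smooth hV hVU hξ
  have hη' := h.smooth hV hVU hη
  have hζ' := h.smooth hV hVU hζ
  rw [neutral_nijenhuisBig h hV hVU hξ hη hζ hx, neutral_nijenhuisBig h hV hVU hξ hζ hη hx]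
  have h1 := dorfmanPairing_add_swap_right (ξ := ξ) hV hη hζ hx
  have h2 := dorfmanPairing_add_swap_right (ξ := ξ) hV hη' hζ' hx
  have h3 := dorfmanPairing_add_swap_right (ξ := fun y => ofTriple A P S y (ξ y)) hV hη' hζ hx
  have h4 := dorfmanPairing_add_swap_right (ξ := fun y => ofTriple A P S y (ξ y)) hV hη hζ' hx
  simp only [h.ofTriple_skew, h.ofTriple_sq, neutral_neg_right, neg_neg] at h1 h2 h3 h4
  rw [dirDeriv_neg] at h3
  linarith

theorem nijenhuisBig_swap_left (h : IsAlmostComplexTriple A P S U) {ξ η ζ : BigField E M}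
    {V : Set M} (hV : IsOpen V) (hVU : V ⊆ U) (hξ : SmoothBigOn ξ V) (hη : SmoothBigOn η V)
    (hζ : SmoothBigOn ζ V) {x : M} (hx : x ∈ V) :
    neutral (nijenhuisBig (ofTriple A P S) ξ η x) (ζ x)
      = - neutral (nijenhuisBig (ofTriple A P S) η ξ x) (ζ x) := by
  have hξ' := h.smooth hV hVU hξ
  have hη' := h.smooth hV hVU hη
  have hζ' := h.smooth hV hVU hζ
  rw [neutral_nijenhuisBig h hV hVU hξ hη hζ hx, neutral_nijenhuisBig h hV hVU hη hξ hζ hx]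
  have h1 := dorfmanPairing_add_swap_left (ζ := ζ) hV hξ hη hx
  have h2 := dorfmanPairing_add_swap_left (ζ := ζ) hV hξ' hη' hx
  have h3 := dorfmanPairing_add_swap_left (ζ := fun y => ofTriple A P S y (ζ y)) hV hξ' hη hx
  have h4 := dorfmanPairing_add_swap_left (ζ := fun y => ofTriple A P S y (ζ y)) hV hξ hη' hx
  simp only [h.ofTriple_skew, h.ofTriple_sq, neutral_neg_right, neg_neg] at h1 h2 h3 h4
  rw [dirDeriv_neg] at h3
  linarith

/-- A vector field as a section of the big tangent bundle. -/
def vecSection (X : VecField E M) : BigField E M := fun x => (X x, 0)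

/-- A 1-form as a section of the big tangent bundle. -/
def formSection (α : OneForm E M) : BigField E M := fun x => (0, α x)

theorem smoothBigOn_vecSection {X : VecField E M} {V : Set M} (hX : SmoothVecOn X V) :
    SmoothBigOn (vecSection X) V := ⟨hX, smoothFormOn_zero V⟩

theorem smoothBigOn_formSection {α : OneForm E M} {V : Set M} (hα : SmoothFormOn α V) :
    SmoothBigOn (formSection α) V := ⟨smoothVecOn_zero V, hα⟩

theorem ofTriple_vecSection (X : VecField E M) (y : M) :
    ofTriple A P S y (vecSection X y) = (A y (X y), S y (X y)) := by
  ext v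
  · simp [ofTriple_apply, vecSection]
  · simp [ofTriple_apply, vecSection]

theorem ofTriple_formSection (α : OneForm E M) (y : M) :
    ofTriple A P S y (formSection α y) = (P y (α y), - covComp (α y) (A y)) := by
  ext v
  · simp [ofTriple_apply, formSection]
  · simp [ofTriple_apply, formSection]

theorem neutral_vecSection_add_formSection {x : M} (ν : BigFiber E x) (ζ : BigField E M) :
    neutral ν (ζ x) = neutral ν (vecSection (fun y => (ζ y).1) x)
      + neutral ν (formSection (fun y => (ζ y).2) x) := by
  simp [neutral, vecSection, formSection]; ring

end Torsion

/-! ### The four components of the torsion on pure vectors and covectors. -/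

section Components

variable {E : Type*} [NormedAddCommGroup E] [NormedSpace ℝ E] [FiniteDimensional ℝ E]
  {M : Type*} [TopologicalSpace M] [ChartedSpace E M] [IsManifold 𝓘(ℝ, E) ∞ M]

/-- The Schouten concomitant of `(P, A)`. -/
def concomitantOf (A : EndField E M) (P : SharpField E M) (α : OneForm E M) (X : VecField E M) :
    VecField E M := fun x =>
  P x (lieDeriv X (fun y => covComp (α y) (A y)) x - lieDeriv (fun y => A y (X y)) α x)
    - lieDerivEnd (fun y => P y (α y)) A X x

variable {A : EndField E M} {P : SharpField E M} {S : FlatField E M} {U : Set M}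

/-- Only the Dorfman pairings with two transformed arguments survive, because covector sections have
no vector part. The constant is 1/4 rather than 1/2 since `schouten P P` counts every Lie derivative
twice. -/
theorem neutral_nijenhuisBig_form_form_form (h : IsAlmostComplexTriple A P S U)
    {α β γ : OneForm E M} {V : Set M} (hV : IsOpen V) (hVU : V ⊆ U) (hα : SmoothFormOn α V)
    (hβ : SmoothFormOn β V) (hγ : SmoothFormOn γ V) {x : M} (hx : x ∈ V) :
    neutral (nijenhuisBig (ofTriple A P S) (formSection α) (formSection β) x) (formSection γ x)
      = - (1 / 4) * schouten P P α β γ x := by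
  rw [neutral_nijenhuisBig h hV hVU (smoothBigOn_formSection hα) (smoothBigOn_formSection hβ)
    (smoothBigOn_formSection hγ) hx]
  have ha := h.smooth_sharp V hV hVU _ hα
  have hb := h.smooth_sharp V hV hVU _ hβ
  have hc := h.smooth_sharp V hV hVU _ hγ
  simp only [schouten]
  rw [hβ.lieDeriv_apply hV hc hx, hγ.lieDeriv_apply hV ha hx, hα.lieDeriv_apply hV hb hx]
  simp only [dorfmanPairing, ofTriple_formSection]
  simp only [formSection, map_zero, lie_zero_left,
    lie_zero_right, dirDeriv_const, dirDeriv_zero_field]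
  rw [lie_swap (fun y => P y (β y)) (fun y => P y (α y)),
    lie_swap (fun y => P y (γ y)) (fun y => P y (β y))]
  simp only [fun y => h.sharp_skew y (γ y) (α y), dirDeriv_neg, map_neg]
  ring

theorem neutral_nijenhuisBig_vec_form_form (h : IsAlmostComplexTriple A P S U)
    {X : VecField E M} {α β : OneForm E M} {V : Set M} (hV : IsOpen V) (hVU : V ⊆ U)
    (hX : SmoothVecOn X V) (hα : SmoothFormOn α V) (hβ : SmoothFormOn β V) {x : M} (hx : x ∈ V) :
    neutral (nijenhuisBig (ofTriple A P S) (vecSection X) (formSection α) x) (formSection β x)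
      = (1 / 2) * β x (concomitantOf A P α X x) := by
  rw [neutral_nijenhuisBig h hV hVU (smoothBigOn_vecSection hX) (smoothBigOn_formSection hα)
    (smoothBigOn_formSection hβ) hx]
  have hb := h.smooth_sharp V hV hVU _ hβ
  have hαA := h.smooth_comp V hV hVU _ hα
  simp only [concomitantOf, lieDerivEnd, map_sub]
  rw [h.sharp_skew, h.sharp_skew x (β x) (lieDeriv _ _ _), hα.lieDeriv_apply hV hb hx,
    hαA.lieDeriv_apply hV hb hx]
  rw [lie_swap (fun y => P y (α y)), lie_swap (fun y => P y (α y)) X]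
  simp only [dorfmanPairing, ofTriple_formSection, ofTriple_vecSection]
  simp only [vecSection, formSection,
    map_zero, lie_zero_left, lie_zero_right, dirDeriv_const, dirDeriv_zero_field, covComp_apply,
    neg_apply, dirDeriv_neg, map_neg, zero_apply]
  ring

theorem neutral_nijenhuisBig_vec_vec_form (h : IsAlmostComplexTriple A P S U)
    {X Y : VecField E M} {γ : OneForm E M} {V : Set M} (hV : IsOpen V) (hVU : V ⊆ U)
    (hX : SmoothVecOn X V) (hY : SmoothVecOn Y V) (hγ : SmoothFormOn γ V) {x : M} (hx : x ∈ V) :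
    neutral (nijenhuisBig (ofTriple A P S) (vecSection X) (vecSection Y) x) (formSection γ x)
      = (1 / 2) * γ x (nijenhuis A X Y x
          - P x (contractExtDerivTwo (fun y u v => S y u v) X Y x)) := by
  rw [neutral_nijenhuisBig h hV hVU (smoothBigOn_vecSection hX) (smoothBigOn_vecSection hY)
    (smoothBigOn_formSection hγ) hx]
  have hc := h.smooth_sharp V hV hVU _ hγ
  have hSX := h.smooth_flat V hV hVU _ hX
  have hSY := h.smooth_flat V hV hVU _ hY
  rw [map_sub, h.sharp_skew x (γ x) (contractExtDerivTwo _ _ _ _),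
    contractExtDerivTwo_apply h.flat_skew hV hSX hSY hX hY hx (hc.mdiffAt hV hx)]
  -- The undifferentiated term γ([X, Y]) must be traded, through A² + ♯♭ = -Id, for the A²[X, Y] of
  -- the Nijenhuis tensor and the σ([X, Y], ♯γ) of dσ.
  have e := congrArg (γ x) (h.sq x (lie X Y x))
  rw [map_add, map_neg, h.sharp_skew x (γ x) (S x _)] at e
  simp only [dorfmanPairing, ofTriple_formSection, ofTriple_vecSection]
  simp only [vecSection, formSection,
    map_zero, lie_zero_right, dirDeriv_const, dirDeriv_zero_field, covComp_apply,
    neg_apply, zero_apply, nijenhuis, extDerivTwo, map_add, map_sub]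
  rw [lie_swap (fun y => P y (γ y)) X]
  simp only [fun y => h.flat_skew y (P y (γ y)) (X y), dirDeriv_neg, map_neg, neg_apply]
  rw [h.flat_skew x (lie Y _ x), h.flat_skew x (lie X (fun y => P y (γ y)) x)]
  linarith

theorem neutral_nijenhuisBig_vec_vec_vec (h : IsAlmostComplexTriple A P S U)
    {X Y Z : VecField E M} {V : Set M} (hV : IsOpen V) (hVU : V ⊆ U)
    (hX : SmoothVecOn X V) (hY : SmoothVecOn Y V) (hZ : SmoothVecOn Z V) {x : M} (hx : x ∈ V) :
    neutral (nijenhuisBig (ofTriple A P S) (vecSection X) (vecSection Y) x) (vecSection Z x)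
      = - (1 / 2) * (extDerivTwo (fun y u v => S y (A y u) v) X Y Z x
          - (extDerivTwo (fun y u v => S y u v) (fun y => A y (X y)) Y Z x
            + extDerivTwo (fun y u v => S y u v) (fun y => A y (Y y)) Z X x
            + extDerivTwo (fun y u v => S y u v) (fun y => A y (Z y)) X Y x)) := by
  rw [neutral_nijenhuisBig h hV hVU (smoothBigOn_vecSection hX) (smoothBigOn_vecSection hY)
    (smoothBigOn_vecSection hZ) hx]
  simp only [dorfmanPairing, ofTriple_vecSection]
  simp only [vecSection, dirDeriv_const, zero_apply, extDerivTwo]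
  have l : ∀ (w u : TangentSpace 𝓘(ℝ, E) x), S x w u = - S x u w := h.flat_skew x
  rw [lie_swap Z (fun y => A y (X y)), lie_swap (fun y => A y (Z y)) X]
  -- σ_A is itself a 2-form. This brings all terms to one orientation, after which the two sides
  -- agree as polynomials.
  have k : ∀ (V W : VecField E M) y, S y (V y) (A y (W y)) = - S y (W y) (A y (V y)) :=
    fun V W y => by rw [h.flat_skew, h.flat_end]
  simp only [h.flat_end, map_neg, neg_apply]
  simp only [l (lie _ _ x), h.flat_end,
    fun y => h.flat_skew y (Z y) (X y), k Z X, dirDeriv_neg]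
  ring

end Components

/-! ### The pointwise Lee conditions and their equivalence with vanishing torsion. -/

section Lee

variable {E : Type*} [NormedAddCommGroup E] [NormedSpace ℝ E] [FiniteDimensional ℝ E]
  {M : Type*} [TopologicalSpace M] [ChartedSpace E M] [IsManifold 𝓘(ℝ, E) ∞ M]

/-- The conditions relating the tensor fields `(A, P, S)` and a covector `κ` at the point `x`. -/
structure LeeAt (A : EndField E M) (P : SharpField E M) (S : FlatField E M) (x : M)
    (κ : TangentSpace 𝓘(ℝ, E) x →L[ℝ] ℝ) : Prop where
  poisson : ∀ V : Set M, IsOpen V → x ∈ V → ∀ α β γ : OneForm E M,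
    SmoothFormOn α V → SmoothFormOn β V → SmoothFormOn γ V →
      schouten P P α β γ x = -2 * wedgeVecBivec (P x κ) (P x) (α x) (β x) (γ x)
  concomitant : ∀ V : Set M, IsOpen V → x ∈ V → ∀ (α : OneForm E M) (X : VecField E M),
    SmoothFormOn α V → SmoothVecOn X V →
      concomitantOf A P α X x = κ (X x) • A x (P x (α x)) - κ (A x (X x)) • P x (α x)
  nijenhuis : ∀ V : Set M, IsOpen V → x ∈ V → ∀ X Y : VecField E M,
    SmoothVecOn X V → SmoothVecOn Y V →
      GenCx.nijenhuis A X Y x - P x (contractExtDerivTwo (fun y u v => S y u v) X Y x)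
        = -(S x (X x) (Y x) • P x κ) + κ (X x) • (Y x + A x (A x (Y x)))
          - κ (Y x) • (X x + A x (A x (X x)))
  associated : ∀ V : Set M, IsOpen V → x ∈ V → ∀ X Y Z : VecField E M,
    SmoothVecOn X V → SmoothVecOn Y V → SmoothVecOn Z V →
      extDerivTwo (fun y u v => S y (A y u) v) X Y Z x
          - (extDerivTwo (fun y u v => S y u v) (fun y => A y (X y)) Y Z x
            + extDerivTwo (fun y u v => S y u v) (fun y => A y (Y y)) Z X x
            + extDerivTwo (fun y u v => S y u v) (fun y => A y (Z y)) X Y x)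
        = -(wedgeOneTwo (fun v => κ v) (fun u v => S x (A x u) v) (X x) (Y x) (Z x)
            + wedgeOneTwo (fun v => κ (A x v)) (fun u v => S x u v) (X x) (Y x) (Z x))

@[simp] theorem covComp_zero {x : M}
    (A : TangentSpace 𝓘(ℝ, E) x →ₗ[ℝ] TangentSpace 𝓘(ℝ, E) x) :
    covComp (0 : TangentSpace 𝓘(ℝ, E) x →L[ℝ] ℝ) A = 0 := by
  ext v; simp

theorem leeConditions_iff (Φ : GenAlmostComplex E M) (ϖ : OneForm E M) :
    LeeConditions Φ ϖ ↔ ∀ x, LeeAt Φ.A Φ.sharp Φ.flat x (ϖ x) :=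
  ⟨fun h x => ⟨fun V hV hx α β γ hα hβ hγ => h.1 V hV α β γ hα hβ hγ x hx,
      fun V hV hx α X hα hX => h.2 V hV α X hα hX x hx,
      fun V hV hx X Y hX hY => h.3 V hV X Y hX hY x hx,
      fun V hV hx X Y Z hX hY hZ => h.4 V hV X Y Z hX hY hZ x hx⟩,
    fun h => ⟨fun V hV α β γ hα hβ hγ x hx => (h x).1 V hV hx α β γ hα hβ hγ,
      fun V hV α X hα hX x hx => (h x).2 V hV hx α X hα hX,
      fun V hV X Y hX hY x hx => (h x).3 V hV hx X Y hX hY,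
      fun V hV X Y Z hX hY hZ x hx => (h x).4 V hV hx X Y Z hX hY hZ⟩⟩

theorem vector_eq_zero_of_forall_smoothFormOn {x : M} {v : TangentSpace 𝓘(ℝ, E) x} {U : Set M}
    (hU : IsOpen U) (hx : x ∈ U) (h : ∀ V : Set M, IsOpen V → x ∈ V → V ⊆ U →
      ∀ α : OneForm E M, SmoothFormOn α V → α x v = 0) : v = 0 := by
  by_contra hv
  have : SeparatingDual ℝ (TangentSpace 𝓘(ℝ, E) x) := inferInstanceAs (SeparatingDual ℝ E)
  obtain ⟨a, ha⟩ := SeparatingDual.exists_ne_zero (R := ℝ) hv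
  obtain ⟨V, hV, hxV, α, hα, hαx⟩ := exists_smoothFormOn x a
  apply ha
  rw [← h (V ∩ U) (hV.inter hU) ⟨hxV, hx⟩ inter_subset_right α (hα.mono inter_subset_left), hαx]

theorem bigFiber_eq_zero {x : M} {ν : BigFiber E x} {U : Set M}
    (hU : IsOpen U) (hx : x ∈ U) (h : ∀ V : Set M, IsOpen V → x ∈ V → V ⊆ U →
      ∀ ζ : BigField E M, SmoothBigOn ζ V → neutral ν (ζ x) = 0) : ν = 0 := by
  refine Prod.ext ?_ ?_
  · refine vector_eq_zero_of_forall_smoothFormOn hU hx fun V hV hxV hVU α hα => ?_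
    simpa [neutral, formSection] using h V hV hxV hVU _ (smoothBigOn_formSection hα)
  · refine covector_ext hU hx fun V hV hxV hVU X hX => ?_
    simpa [neutral, vecSection] using h V hV hxV hVU _ (smoothBigOn_vecSection hX)

variable {A : EndField E M} {P : SharpField E M} {S : FlatField E M} {U : Set M}

/-- The torsion of a generalized almost complex structure vanishes at a point if and only if its
four components in terms of the classical tensor fields do. -/
theorem nijenhuisBig_eq_zero_iff_leeAt_zero (h : IsAlmostComplexTriple A P S U) (hU : IsOpen U)
    {x : M} (hx : x ∈ U) :
    (∀ V : Set M, IsOpen V → x ∈ V → V ⊆ U → ∀ ξ η : BigField E M, SmoothBigOn ξ V →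
      SmoothBigOn η V → nijenhuisBig (ofTriple A P S) ξ η x = 0) ↔ LeeAt A P S x 0 := by
  constructor
  · intro H
    refine ⟨fun V hV hxV α β γ hα hβ hγ => ?_, fun V hV hxV α X hα hX => ?_,
      fun V hV hxV X Y hX hY => ?_, fun V hV hxV X Y Z hX hY hZ => ?_⟩
    · have hsub : V ∩ U ⊆ V := inter_subset_left
      have e := neutral_nijenhuisBig_form_form_form h (hV.inter hU) inter_subset_right
        (hα.mono hsub) (hβ.mono hsub) (hγ.mono hsub) ⟨hxV, hx⟩
      rw [H _ (hV.inter hU) ⟨hxV, hx⟩ inter_subset_right _ _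
        (smoothBigOn_formSection (hα.mono hsub)) (smoothBigOn_formSection (hβ.mono hsub))] at e
      simp [neutral] at e
      simp [e, wedgeVecBivec]
    · simp only [zero_apply, zero_smul, sub_zero]
      refine vector_eq_zero_of_forall_smoothFormOn (hV.inter hU) ⟨hxV, hx⟩
        fun W hW hxW hWV β hβ => ?_
      have hsub : W ⊆ V := hWV.trans inter_subset_left
      have hWU : W ⊆ U := hWV.trans inter_subset_right
      have e := neutral_nijenhuisBig_vec_form_form h hW hWU (hX.mono hsub) (hα.mono hsub) hβ hxW
      rw [H _ hW hxW hWU _ _ (smoothBigOn_vecSection (hX.mono hsub))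
        (smoothBigOn_formSection (hα.mono hsub))] at e
      simpa [neutral] using e.symm
    · simp only [zero_apply, zero_smul, sub_zero, map_zero, smul_zero, neg_zero, add_zero]
      refine vector_eq_zero_of_forall_smoothFormOn (hV.inter hU) ⟨hxV, hx⟩
        fun W hW hxW hWV β hβ => ?_
      have hsub : W ⊆ V := hWV.trans inter_subset_left
      have hWU : W ⊆ U := hWV.trans inter_subset_right
      have e := neutral_nijenhuisBig_vec_vec_form h hW hWU (hX.mono hsub) (hY.mono hsub) hβ hxW
      rw [H _ hW hxW hWU _ _ (smoothBigOn_vecSection (hX.mono hsub))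
        (smoothBigOn_vecSection (hY.mono hsub))] at e
      simp only [neutral, Prod.fst_zero, Prod.snd_zero, zero_apply, map_zero, add_zero,
        mul_zero] at e
      linarith
    · have hsub : V ∩ U ⊆ V := inter_subset_left
      have e := neutral_nijenhuisBig_vec_vec_vec h (hV.inter hU) inter_subset_right
        (hX.mono hsub) (hY.mono hsub) (hZ.mono hsub) ⟨hxV, hx⟩
      rw [H _ (hV.inter hU) ⟨hxV, hx⟩ inter_subset_right _ _
        (smoothBigOn_vecSection (hX.mono hsub)) (smoothBigOn_vecSection (hY.mono hsub))] at e
      simp only [wedgeOneTwo, zero_apply, zero_mul, add_zero, neg_zero]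
      simp only [neutral, Prod.fst_zero, Prod.snd_zero, zero_apply, map_zero, add_zero,
        mul_zero] at e
      linarith
  · intro H V hV hxV hVU ξ η hξ hη
    refine bigFiber_eq_zero hV hxV fun W hW hxW hWV ζ hζ => ?_
    have hWU := hWV.trans hVU
    replace hξ := hξ.mono hWV
    replace hη := hη.mono hWV
    have vvv : ∀ X Y Z : VecField E M, SmoothVecOn X W → SmoothVecOn Y W → SmoothVecOn Z W →
        neutral (nijenhuisBig (ofTriple A P S) (vecSection X) (vecSection Y) x)
          (vecSection Z x) = 0 := fun X Y Z hX hY hZ => by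
      rw [neutral_nijenhuisBig_vec_vec_vec h hW hWU hX hY hZ hxW,
        H.associated W hW hxW X Y Z hX hY hZ]
      simp [wedgeOneTwo]
    have vvf : ∀ (X Y : VecField E M) (γ : OneForm E M), SmoothVecOn X W → SmoothVecOn Y W →
        SmoothFormOn γ W →
        neutral (nijenhuisBig (ofTriple A P S) (vecSection X) (vecSection Y) x)
          (formSection γ x) = 0 := fun X Y γ hX hY hγ => by
      rw [neutral_nijenhuisBig_vec_vec_form h hW hWU hX hY hγ hxW,
        H.nijenhuis W hW hxW X Y hX hY]
      simp
    have vff : ∀ (X : VecField E M) (β γ : OneForm E M), SmoothVecOn X W → SmoothFormOn β W →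
        SmoothFormOn γ W →
        neutral (nijenhuisBig (ofTriple A P S) (vecSection X) (formSection β) x)
          (formSection γ x) = 0 := fun X β γ hX hβ hγ => by
      rw [neutral_nijenhuisBig_vec_form_form h hW hWU hX hβ hγ hxW,
        H.concomitant W hW hxW β X hβ hX]
      simp
    have fff : ∀ (α β γ : OneForm E M), SmoothFormOn α W → SmoothFormOn β W →
        SmoothFormOn γ W →
        neutral (nijenhuisBig (ofTriple A P S) (formSection α) (formSection β) x)
          (formSection γ x) = 0 := fun α β γ hα hβ hγ => by
      rw [neutral_nijenhuisBig_form_form_form h hW hWU hα hβ hγ hxW,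
        H.poisson W hW hxW α β γ hα hβ hγ]
      simp [wedgeVecBivec]
    -- Splitting a section into vector and covector parts is immediate only in the last slot, where
    -- the metric is bilinear at the point. The other slots are split by carrying them to the last
    -- one with the two swaps, so additivity of the bracket is never needed.
    have sv : ∀ {θ : BigField E M}, SmoothBigOn θ W →
        SmoothBigOn (vecSection fun y => (θ y).1) W := fun hθ => smoothBigOn_vecSection hθ.1
    have sf : ∀ {θ : BigField E M}, SmoothBigOn θ W →
        SmoothBigOn (formSection fun y => (θ y).2) W := fun hθ => smoothBigOn_formSection hθ.2
    have swl := fun {ξ η ζ : BigField E M} (hξ : SmoothBigOn ξ W) (hη : SmoothBigOn η W)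
      (hζ : SmoothBigOn ζ W) => nijenhuisBig_swap_left h hW hWU hξ hη hζ hxW
    have swr := fun {ξ η ζ : BigField E M} (hξ : SmoothBigOn ξ W) (hη : SmoothBigOn η W)
      (hζ : SmoothBigOn ζ W) => nijenhuisBig_swap_right h hW hWU hξ hη hζ hxW
    have vv : ∀ {X Y : VecField E M} {θ : BigField E M}, SmoothVecOn X W → SmoothVecOn Y W →
        SmoothBigOn θ W → neutral (nijenhuisBig (ofTriple A P S) (vecSection X) (vecSection Y) x)
          (θ x) = 0 := fun hX hY hθ => by
      rw [neutral_vecSection_add_formSection, vvv _ _ _ hX hY hθ.1, vvf _ _ _ hX hY hθ.2, add_zero]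
    have vf : ∀ {X : VecField E M} {β : OneForm E M} {θ : BigField E M}, SmoothVecOn X W →
        SmoothFormOn β W → SmoothBigOn θ W →
        neutral (nijenhuisBig (ofTriple A P S) (vecSection X) (formSection β) x)
          (θ x) = 0 := fun hX hβ hθ => by
      rw [neutral_vecSection_add_formSection, vff _ _ _ hX hβ hθ.2,
        swr (smoothBigOn_vecSection hX) (smoothBigOn_formSection hβ) (sv hθ),
        vvf _ _ _ hX hθ.1 hβ, neg_zero, add_zero]
    have ff : ∀ {α β : OneForm E M} {θ : BigField E M}, SmoothFormOn α W →
        SmoothFormOn β W → SmoothBigOn θ W →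
        neutral (nijenhuisBig (ofTriple A P S) (formSection α) (formSection β) x)
          (θ x) = 0 := fun hα hβ hθ => by
      rw [neutral_vecSection_add_formSection, fff _ _ _ hα hβ hθ.2,
        swr (smoothBigOn_formSection hα) (smoothBigOn_formSection hβ) (sv hθ),
        swl (smoothBigOn_formSection hα) (sv hθ) (smoothBigOn_formSection hβ),
        vff _ _ _ hθ.1 hα hβ, neg_zero, neg_zero, add_zero]
    have v : ∀ {X : VecField E M} {θ θ' : BigField E M}, SmoothVecOn X W → SmoothBigOn θ W →
        SmoothBigOn θ' W → neutral (nijenhuisBig (ofTriple A P S) (vecSection X) θ x) (θ' x) = 0 :=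
      fun hX hθ hθ' => by
        rw [swr (smoothBigOn_vecSection hX) hθ hθ', neutral_vecSection_add_formSection,
          swr (smoothBigOn_vecSection hX) hθ' (sv hθ), swr (smoothBigOn_vecSection hX) hθ' (sf hθ),
          vv hX hθ.1 hθ', vf hX hθ.2 hθ', neg_zero, add_zero, neg_zero]
    have f : ∀ {α : OneForm E M} {θ θ' : BigField E M}, SmoothFormOn α W → SmoothBigOn θ W →
        SmoothBigOn θ' W → neutral (nijenhuisBig (ofTriple A P S) (formSection α) θ x) (θ' x) = 0 :=
      fun hα hθ hθ' => by
        rw [swr (smoothBigOn_formSection hα) hθ hθ', neutral_vecSection_add_formSection,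
          swr (smoothBigOn_formSection hα) hθ' (sv hθ), swr (smoothBigOn_formSection hα) hθ' (sf hθ),
          swl (smoothBigOn_formSection hα) (sv hθ) hθ',
          vf hθ.1 hα hθ', ff hα hθ.2 hθ', neg_zero, neg_zero, add_zero, neg_zero]
    rw [swl hξ hη hζ, swr hη hξ hζ, neutral_vecSection_add_formSection,
      swr hη hζ (sv hξ), swr hη hζ (sf hξ), swl hη (sv hξ) hζ, swl hη (sf hξ) hζ,
      v hξ.1 hη hζ, f hξ.2 hη hζ]
    simp

end Lee

/-! ### Extracting the triple (A, π, σ) from Φ. -/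

section OfStructure

variable {E : Type*} [NormedAddCommGroup E] [NormedSpace ℝ E] [FiniteDimensional ℝ E]
  {M : Type*} [TopologicalSpace M] [ChartedSpace E M] [IsManifold 𝓘(ℝ, E) ∞ M]

namespace GenAlmostComplex

theorem toEnd_vec (Φ : GenAlmostComplex E M) (x : M) (u : TangentSpace 𝓘(ℝ, E) x) :
    Φ.toEnd x (u, 0) = (Φ.A x u, Φ.flat x u) := rfl

/-- Skewness of Φ against pure vectors forces the covector part, which is why three tensors
determine Φ. -/
theorem toEnd_form (Φ : GenAlmostComplex E M) (x : M) (α : TangentSpace 𝓘(ℝ, E) x →L[ℝ] ℝ) :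
    Φ.toEnd x (0, α) = (Φ.sharp x α, - covComp α (Φ.A x)) := by
  refine Prod.ext rfl ?_
  ext v
  have := Φ.skew x (v, 0) (0, α)
  simp [neutral, toEnd_vec] at this
  simp
  linarith

theorem toEnd_eq_ofTriple (Φ : GenAlmostComplex E M) :
    Φ.toEnd = ofTriple Φ.A Φ.sharp Φ.flat := by
  funext x
  refine LinearMap.ext fun ξ => ?_
  have : ξ = (ξ.1, 0) + (0, ξ.2) := by simp
  rw [this, map_add, toEnd_vec, toEnd_form]
  simp [ofTriple_apply, sub_eq_add_neg]

/-- Each algebraic identity is a component of Φ² = -Id or of skewness, read off on pure vectors or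
pure covectors. -/
theorem isAlmostComplexTriple (Φ : GenAlmostComplex E M) :
    IsAlmostComplexTriple Φ.A Φ.sharp Φ.flat univ where
  sharp_skew x α β := by
    have := Φ.skew x (0, α) (0, β)
    simp [neutral, toEnd_form] at this
    linarith
  flat_skew x u v := by
    have := Φ.skew x (u, 0) (v, 0)
    simp [neutral, toEnd_vec] at this
    linarith
  sq x u := by
    have := congrArg Prod.fst (Φ.sq x (u, 0))
    rw [Φ.toEnd_eq_ofTriple] at this
    simpa [ofTriple_apply] using this
  end_sharp x α := by
    have := congrArg Prod.fst (Φ.sq x (0, α))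
    rw [Φ.toEnd_eq_ofTriple] at this
    simp [ofTriple_apply] at this
    rwa [← sub_eq_add_neg, sub_eq_zero] at this
  flat_end x u v := by
    have := congrArg Prod.snd (Φ.sq x (u, 0))
    rw [Φ.toEnd_eq_ofTriple] at this
    simp [ofTriple_apply, sub_eq_zero] at this
    rw [this]
    rfl
  smooth_end V hV _ X hX := (Φ.smooth V hV _ (smoothBigOn_vecSection hX)).1
  smooth_flat V hV _ X hX := (Φ.smooth V hV _ (smoothBigOn_vecSection hX)).2
  smooth_sharp V hV _ α hα := (Φ.smooth V hV _ (smoothBigOn_formSection hα)).1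
  smooth_comp V hV _ α hα := by
    have h1 := (Φ.smooth V hV _ (smoothBigOn_formSection hα)).2
    have h2 := (smoothFormOn_zero V).sub h1
    have e : ∀ y, (0 : TangentSpace 𝓘(ℝ, E) y →L[ℝ] ℝ) - (Φ.toEnd y (formSection α y)).2
        = covComp (α y) (Φ.A y) := fun y => by
      rw [formSection, toEnd_form]; simp
    simpa only [e] using h2

end GenAlmostComplex

end OfStructure

/-! ### Effect of a conformal change on the torsion components. -/

section ConformalChange

variable {E : Type*} [NormedAddCommGroup E] [NormedSpace ℝ E] [FiniteDimensional ℝ E]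
  {M : Type*} [TopologicalSpace M] [ChartedSpace E M] [IsManifold 𝓘(ℝ, E) ∞ M]

theorem contMDiffOn_exp {τ : M → ℝ} {U : Set M} (hτ : ContMDiffOn 𝓘(ℝ, E) 𝓘(ℝ, ℝ) ∞ τ U) :
    ContMDiffOn 𝓘(ℝ, E) 𝓘(ℝ, ℝ) ∞ (fun y => Real.exp (τ y)) U :=
  Real.contDiff_exp.contMDiff.comp_contMDiffOn hτ

theorem diff_exp {τ : M → ℝ} {x : M} (hτ : MDifferentiableAt 𝓘(ℝ, E) 𝓘(ℝ, ℝ) τ x) :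
    (diff (fun y => Real.exp (τ y)) x : TangentSpace 𝓘(ℝ, E) x →L[ℝ] ℝ)
      = Real.exp (τ x) • diff τ x := by
  have h := (Real.hasDerivAt_exp (τ x)).hasFDerivAt.hasMFDerivAt.comp x hτ.hasMFDerivAt
  have h' := h.mfderiv
  ext v
  exact Eq.trans (congrArg (fun L => L v) h') (mul_comm _ _)

theorem dirDeriv_exp (X : VecField E M) {τ : M → ℝ} {x : M}
    (hτ : MDifferentiableAt 𝓘(ℝ, E) 𝓘(ℝ, ℝ) τ x) :
    dirDeriv X (fun y => Real.exp (τ y)) x = Real.exp (τ x) * dirDeriv X τ x :=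
  congrArg (fun L => L (X x)) (diff_exp hτ)

variable {A : EndField E M} {P : SharpField E M} {S : FlatField E M} {U : Set M}

theorem conformalConj_ofTriple (τ : M → ℝ) :
    conformalConj τ (ofTriple A P S)
      = ofTriple A (fun y => Real.exp (τ y) • P y) (fun y => Real.exp (-τ y) • S y) := by
  funext x
  refine LinearMap.ext fun ξ => ?_
  refine Prod.ext ?_ ?_
  · simp [conformalConj, conformal, ofTriple_apply]
  · ext v
    simp [conformalConj, conformal, ofTriple_apply, mul_sub, ← mul_assoc, ← Real.exp_add]

/-- The factors e^τ and e^{-τ} cancel in `sq` and the other identities are homogeneous, so the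
algebra holds at every point. Only smoothness has to be restricted to the set where τ is smooth. -/
theorem IsAlmostComplexTriple.conformal (h : IsAlmostComplexTriple A P S U) {τ : M → ℝ}
    {V : Set M} (hVU : V ⊆ U) (hτ : ContMDiffOn 𝓘(ℝ, E) 𝓘(ℝ, ℝ) ∞ τ V) :
    IsAlmostComplexTriple A (fun y => Real.exp (τ y) • P y) (fun y => Real.exp (-τ y) • S y) V where
  sharp_skew x α β := by simp [h.sharp_skew x α β]
  flat_skew x u v := by simp [h.flat_skew x u v]
  sq x u := by simp [smul_smul, ← Real.exp_add, h.sq]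
  end_sharp x α := by simp [h.end_sharp]
  flat_end x u v := by simp [h.flat_end]
  smooth_end W hW hWV := h.smooth_end W hW (hWV.trans hVU)
  smooth_flat W hW hWV X hX := (h.smooth_flat W hW (hWV.trans hVU) X hX).smul
    (contMDiffOn_exp (hτ.neg.mono hWV))
  smooth_sharp W hW hWV α hα := (h.smooth_sharp W hW (hWV.trans hVU) α hα).smul
    (contMDiffOn_exp (hτ.mono hWV))
  smooth_comp W hW hWV := h.smooth_comp W hW (hWV.trans hVU)

/-- The df term is what produces the Lee term in the Schouten bracket. -/
theorem lieDeriv_smul_field {X Z : VecField E M} {β : OneForm E M} {f : M → ℝ} {V : Set M}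
    (hV : IsOpen V) (hX : SmoothVecOn X V) (hZ : SmoothVecOn Z V) (hβ : SmoothFormOn β V)
    {x : M} (hx : x ∈ V) (hf : MDifferentiableAt 𝓘(ℝ, E) 𝓘(ℝ, ℝ) f x) :
    lieDeriv (fun y => f y • X y) β x (Z x)
      = f x * lieDeriv X β x (Z x) + dirDeriv Z f x * β x (X x) := by
  rw [hβ.lieDeriv_apply hV hZ hx, hβ.lieDeriv_apply hV hZ hx, lie_smul_left Z hV hX hx hf]
  simp [dirDeriv]
  ring

theorem schouten_conformal (h : IsAlmostComplexTriple A P S U) {τ : M → ℝ} {α β γ : OneForm E M}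
    {V : Set M} (hV : IsOpen V) (hVU : V ⊆ U) (hα : SmoothFormOn α V) (hβ : SmoothFormOn β V)
    (hγ : SmoothFormOn γ V) {x : M} (hx : x ∈ V)
    (hτ : MDifferentiableAt 𝓘(ℝ, E) 𝓘(ℝ, ℝ) τ x) :
    schouten (fun y => Real.exp (τ y) • P y) (fun y => Real.exp (τ y) • P y) α β γ x
      = Real.exp (τ x) ^ 2 * (schouten P P α β γ x
        + 2 * wedgeVecBivec (P x (diff τ x)) (P x) (α x) (β x) (γ x)) := by
  have ha := h.smooth_sharp V hV hVU _ hα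
  have hb := h.smooth_sharp V hV hVU _ hβ
  have hc := h.smooth_sharp V hV hVU _ hγ
  have hf : MDifferentiableAt 𝓘(ℝ, E) 𝓘(ℝ, ℝ) (fun y => Real.exp (τ y)) x :=
    Real.differentiableAt_exp.mdifferentiableAt.comp x hτ
  simp only [schouten, LinearMap.smul_apply, map_smul, smul_eq_mul]
  rw [lieDeriv_smul_field hV ha hc hβ hx hf, lieDeriv_smul_field hV hb ha hγ hx hf,
    lieDeriv_smul_field hV hc hb hα hx hf]
  simp only [dirDeriv_exp _ hτ, wedgeVecBivec, h.sharp_skew x _ (diff τ x),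
    ← diff_apply τ]
  ring

/-- The Lie derivatives inside ♯ do not see the change; the correction comes from L_{fV}A with V =
♯α, namely (Xf) A V - ((AX)f) V for f = e^τ. -/
theorem concomitantOf_conformal (h : IsAlmostComplexTriple A P S U) {τ : M → ℝ}
    {α : OneForm E M} {X : VecField E M} {V : Set M} (hV : IsOpen V) (hVU : V ⊆ U)
    (hα : SmoothFormOn α V) {x : M} (hx : x ∈ V)
    (hτ : MDifferentiableAt 𝓘(ℝ, E) 𝓘(ℝ, ℝ) τ x) :
    concomitantOf A (fun y => Real.exp (τ y) • P y) α X x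
      = Real.exp (τ x) • (concomitantOf A P α X x
        - (diff τ x (X x) • A x (P x (α x)) - diff τ x (A x (X x)) • P x (α x))) := by
  have ha := h.smooth_sharp V hV hVU _ hα
  have hf : MDifferentiableAt 𝓘(ℝ, E) 𝓘(ℝ, ℝ) (fun y => Real.exp (τ y)) x :=
    Real.differentiableAt_exp.mdifferentiableAt.comp x hτ
  simp only [concomitantOf, lieDerivEnd, LinearMap.smul_apply]
  rw [lie_smul_left _ hV ha hx hf, lie_smul_left _ hV ha hx hf]
  simp only [dirDeriv_exp _ hτ, map_add, map_neg, map_smul, diff_apply τ X,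
    diff_apply τ (fun y => A y (X y))]
  module

/-- Only the Leibniz rule on three functions is used, with no linearity or skewness of `s`, so the
lemma serves both σ and σ_A. -/
theorem extDerivTwo_conformal {s : Π x : M, TangentSpace 𝓘(ℝ, E) x → TangentSpace 𝓘(ℝ, E) x → ℝ}
    {τ : M → ℝ} {X Y Z : VecField E M} {x : M}
    (hτ : MDifferentiableAt 𝓘(ℝ, E) 𝓘(ℝ, ℝ) τ x)
    (hXY : MDifferentiableAt 𝓘(ℝ, E) 𝓘(ℝ, ℝ) (fun y => s y (X y) (Y y)) x)
    (hYZ : MDifferentiableAt 𝓘(ℝ, E) 𝓘(ℝ, ℝ) (fun y => s y (Y y) (Z y)) x)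
    (hZX : MDifferentiableAt 𝓘(ℝ, E) 𝓘(ℝ, ℝ) (fun y => s y (Z y) (X y)) x) :
    extDerivTwo (fun y u v => Real.exp (-τ y) * s y u v) X Y Z x
      = Real.exp (-τ x) * (extDerivTwo s X Y Z x
        - wedgeOneTwo (fun v => diff τ x v) (s x) (X x) (Y x) (Z x)) := by
  have hf : MDifferentiableAt 𝓘(ℝ, E) 𝓘(ℝ, ℝ) (fun y => Real.exp (-τ y)) x :=
    Real.differentiableAt_exp.mdifferentiableAt.comp x hτ.neg
  simp only [extDerivTwo, wedgeOneTwo]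
  rw [dirDeriv_mul X hf hYZ, dirDeriv_mul Y hf hZX, dirDeriv_mul Z hf hXY]
  simp only [dirDeriv_exp (τ := fun y => - τ y) _ hτ.neg, dirDeriv_neg, diff_apply τ X,
    diff_apply τ Y, diff_apply τ Z]
  ring

theorem mdiffAt_flat (h : IsAlmostComplexTriple A P S U) {V : Set M} (hV : IsOpen V) (hVU : V ⊆ U)
    {X Y : VecField E M} (hX : SmoothVecOn X V) (hY : SmoothVecOn Y V) {x : M} (hx : x ∈ V) :
    MDifferentiableAt 𝓘(ℝ, E) 𝓘(ℝ, ℝ) (fun y => S y (X y) (Y y)) x :=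
  (h.smooth_flat V hV hVU X hX).mdiffAt_apply hV hY hx

theorem contractExtDerivTwo_conformal (h : IsAlmostComplexTriple A P S U) {τ : M → ℝ}
    {X Y : VecField E M} {V : Set M} (hV : IsOpen V) (hVU : V ⊆ U)
    (hτ : ContMDiffOn 𝓘(ℝ, E) 𝓘(ℝ, ℝ) ∞ τ V)
    (hX : SmoothVecOn X V) (hY : SmoothVecOn Y V) {x : M} (hx : x ∈ V) :
    contractExtDerivTwo (fun y u v => (Real.exp (-τ y) • S y) u v) X Y x
      = Real.exp (-τ x) • (contractExtDerivTwo (fun y u v => S y u v) X Y x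
        - (diff τ x (X x) • S x (Y x) - diff τ x (Y x) • S x (X x)
          + S x (X x) (Y x) • diff τ x)) := by
  have h' := h.conformal hVU hτ
  refine covector_ext hV hx fun W hW hxW hWV Z hZ => ?_
  have hWU := hWV.trans hVU
  have hτx : MDifferentiableAt 𝓘(ℝ, E) 𝓘(ℝ, ℝ) τ x :=
    (hτ.contMDiffAt (hV.mem_nhds hx)).mdifferentiableAt (by simp)
  replace hX := hX.mono hWV
  replace hY := hY.mono hWV
  rw [contractExtDerivTwo_apply (σ := fun y => Real.exp (-τ y) • S y) h'.flat_skew hW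
    (h'.smooth_flat W hW hWV X hX) (h'.smooth_flat W hW hWV Y hY) hX hY hxW (hZ.mdiffAt hW hxW)]
  have e := extDerivTwo_conformal (s := fun y u v => S y u v) hτx
    (mdiffAt_flat h hW hWU hX hY hxW) (mdiffAt_flat h hW hWU hY hZ hxW)
    (mdiffAt_flat h hW hWU hZ hX hxW)
  simp only [LinearMap.smul_apply, smul_apply, smul_eq_mul, sub_apply, add_apply]
  rw [e, contractExtDerivTwo_apply h.flat_skew hW (h.smooth_flat W hW hWU X hX)
    (h.smooth_flat W hW hWU Y hY) hX hY hxW (hZ.mdiffAt hW hxW)]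
  simp only [wedgeOneTwo]
  rw [h.flat_skew x (Z x) (X x)]
  ring

/-- A conformal change by `τ` makes the structure torsion free at `x` if and only if the original
structure satisfies the conditions with the covector `dτ`. -/
theorem leeAt_conformal_iff (h : IsAlmostComplexTriple A P S U) {τ : M → ℝ} {V : Set M}
    (hV : IsOpen V) (hVU : V ⊆ U) (hτ : ContMDiffOn 𝓘(ℝ, E) 𝓘(ℝ, ℝ) ∞ τ V) {x : M} (hx : x ∈ V) :
    LeeAt A (fun y => Real.exp (τ y) • P y) (fun y => Real.exp (-τ y) • S y) x 0
      ↔ LeeAt A P S x (diff τ x) := by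
  have hτx : MDifferentiableAt 𝓘(ℝ, E) 𝓘(ℝ, ℝ) τ x :=
    (hτ.contMDiffAt (hV.mem_nhds hx)).mdifferentiableAt (by simp)
  have hne : Real.exp (τ x) ≠ 0 := Real.exp_ne_zero _
  have key1 : ∀ (W : Set M), IsOpen W → x ∈ W → ∀ α β γ : OneForm E M,
      SmoothFormOn α W → SmoothFormOn β W → SmoothFormOn γ W →
      (schouten (fun y => Real.exp (τ y) • P y) (fun y => Real.exp (τ y) • P y) α β γ x = 0 ↔
        schouten P P α β γ x
          = -2 * wedgeVecBivec (P x (diff τ x)) (P x) (α x) (β x) (γ x)) := by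
    intro W hW hxW α β γ hα hβ hγ
    have hsub : W ∩ V ⊆ W := inter_subset_left
    rw [schouten_conformal h (hW.inter hV) (inter_subset_right.trans hVU) (hα.mono hsub)
      (hβ.mono hsub) (hγ.mono hsub) ⟨hxW, hx⟩ hτx, mul_eq_zero, or_iff_right (pow_ne_zero 2 hne)]
    constructor <;> intro e <;> linarith
  have key2 : ∀ (W : Set M), IsOpen W → x ∈ W → ∀ (α : OneForm E M) (X : VecField E M),
      SmoothFormOn α W →
      (concomitantOf A (fun y => Real.exp (τ y) • P y) α X x = 0 ↔
        concomitantOf A P α X x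
          = diff τ x (X x) • A x (P x (α x)) - diff τ x (A x (X x)) • P x (α x)) := by
    intro W hW hxW α X hα
    rw [concomitantOf_conformal h (hW.inter hV) (inter_subset_right.trans hVU)
      (hα.mono inter_subset_left) ⟨hxW, hx⟩ hτx, smul_eq_zero, or_iff_right hne, sub_eq_zero]
  have key3 : ∀ (W : Set M), IsOpen W → x ∈ W → ∀ X Y : VecField E M,
      SmoothVecOn X W → SmoothVecOn Y W →
      (nijenhuis A X Y x - (Real.exp (τ x) • P x)
          (contractExtDerivTwo (fun y u v => (Real.exp (-τ y) • S y) u v) X Y x) = 0 ↔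
        nijenhuis A X Y x - P x (contractExtDerivTwo (fun y u v => S y u v) X Y x)
        = -(S x (X x) (Y x) • P x (diff τ x)) + diff τ x (X x) • (Y x + A x (A x (Y x)))
          - diff τ x (Y x) • (X x + A x (A x (X x)))) := by
    intro W hW hxW X Y hX hY
    have hsub : W ∩ V ⊆ W := inter_subset_left
    have hsub' : W ∩ V ⊆ V := inter_subset_right
    rw [contractExtDerivTwo_conformal h (hW.inter hV) (hsub'.trans hVU) (hτ.mono hsub')
      (hX.mono hsub) (hY.mono hsub) ⟨hxW, hx⟩]
    -- Since ♯♭ = -(Id + A²), applying ♯ to the correction of i(X ∧ Y)dσ gives the Id + A² terms of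
    -- (iii); the factors e^τ and e^{-τ} then cancel.
    have eX : P x (S x (X x)) = - (X x + A x (A x (X x))) := by
      rw [neg_add, ← h.sq x (X x)]; abel
    have eY : P x (S x (Y x)) = - (Y x + A x (A x (Y x))) := by
      rw [neg_add, ← h.sq x (Y x)]; abel
    rw [LinearMap.smul_apply, map_smul, smul_smul, ← Real.exp_add, add_neg_cancel, Real.exp_zero,
      one_smul]
    simp only [map_sub, map_add, map_smul, eX, eY]
    rw [← sub_eq_zero (b := _ - diff τ x (Y x) • _)]
    refine Eq.congr_left ?_
    module
  have key4 : ∀ (W : Set M), IsOpen W → x ∈ W → ∀ X Y Z : VecField E M,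
      SmoothVecOn X W → SmoothVecOn Y W → SmoothVecOn Z W →
      (extDerivTwo (fun y u v => (Real.exp (-τ y) • S y) (A y u) v) X Y Z x
          - (extDerivTwo (fun y u v => (Real.exp (-τ y) • S y) u v) (fun y => A y (X y)) Y Z x
            + extDerivTwo (fun y u v => (Real.exp (-τ y) • S y) u v) (fun y => A y (Y y)) Z X x
            + extDerivTwo (fun y u v => (Real.exp (-τ y) • S y) u v) (fun y => A y (Z y)) X Y x)
        = 0 ↔
      extDerivTwo (fun y u v => S y (A y u) v) X Y Z x
          - (extDerivTwo (fun y u v => S y u v) (fun y => A y (X y)) Y Z x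
            + extDerivTwo (fun y u v => S y u v) (fun y => A y (Y y)) Z X x
            + extDerivTwo (fun y u v => S y u v) (fun y => A y (Z y)) X Y x)
        = -(wedgeOneTwo (fun v => diff τ x v) (fun u v => S x (A x u) v) (X x) (Y x) (Z x)
            + wedgeOneTwo (fun v => diff τ x (A x v)) (fun u v => S x u v)
              (X x) (Y x) (Z x))) := by
    intro W' hW' hxW' X Y Z hX hY hZ
    obtain ⟨W, hW, hxW, hWV, hWW'⟩ : ∃ W, IsOpen W ∧ x ∈ W ∧ W ⊆ V ∧ W ⊆ W' :=
      ⟨W' ∩ V, hW'.inter hV, ⟨hxW', hx⟩, inter_subset_right, inter_subset_left⟩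
    have hWU := hWV.trans hVU
    replace hX := hX.mono hWW'
    replace hY := hY.mono hWW'
    replace hZ := hZ.mono hWW'
    have hAX := h.smooth_end W hW hWU X hX
    have hAY := h.smooth_end W hW hWU Y hY
    have hAZ := h.smooth_end W hW hWU Z hZ
    have d : ∀ {X Y : VecField E M}, SmoothVecOn X W → SmoothVecOn Y W →
      MDifferentiableAt 𝓘(ℝ, E) 𝓘(ℝ, ℝ) (fun y => S y (X y) (Y y)) x :=
      fun hX hY => mdiffAt_flat h hW hWU hX hY hxW
    simp only [LinearMap.smul_apply, smul_apply, smul_eq_mul]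
    rw [extDerivTwo_conformal (s := fun y u v => S y (A y u) v) hτx (d hAX hY) (d hAY hZ) (d hAZ hX),
      extDerivTwo_conformal (s := fun y u v => S y u v) hτx (d hAX hY) (d hY hZ) (d hZ hAX),
      extDerivTwo_conformal (s := fun y u v => S y u v) hτx (d hAY hZ) (d hZ hX) (d hX hAY),
      extDerivTwo_conformal (s := fun y u v => S y u v) hτx (d hAZ hX) (d hX hY) (d hY hAZ)]
    simp only [wedgeOneTwo]
    rw [h.flat_skew x (Z x) (A x (X x)), h.flat_skew x (X x) (A x (Y x)),
      h.flat_skew x (Y x) (A x (Z x)), ← mul_add, ← mul_add, ← mul_sub, mul_eq_zero,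
      or_iff_right (Real.exp_ne_zero _)]
    -- By skewness of σ_A, the cyclic sum of (dτ ∧ σ)(AX, Y, Z) equals 2 dτ ∧ σ_A + (dτ ∘ A) ∧ σ.
    -- Subtracting the dτ ∧ σ_A coming from dσ_A leaves coefficient one on each wedge.
    have e1 : S x (A x (X x)) (Z x) = - S x (A x (Z x)) (X x) := by rw [h.flat_skew, h.flat_end]
    have e2 : S x (A x (Y x)) (X x) = - S x (A x (X x)) (Y x) := by rw [h.flat_skew, h.flat_end]
    have e3 : S x (A x (Z x)) (Y x) = - S x (A x (Y x)) (Z x) := by rw [h.flat_skew, h.flat_end]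
    rw [e1, e2, e3]
    constructor <;> intro e <;> linarith
  constructor
  · intro H
    refine ⟨fun W hW hxW α β γ hα hβ hγ => (key1 W hW hxW α β γ hα hβ hγ).1 ?_,
      fun W hW hxW α X hα hX => (key2 W hW hxW α X hα).1 ?_,
      fun W hW hxW X Y hX hY => (key3 W hW hxW X Y hX hY).1 ?_,
      fun W hW hxW X Y Z hX hY hZ => (key4 W hW hxW X Y Z hX hY hZ).1 ?_⟩
    · rw [H.poisson W hW hxW α β γ hα hβ hγ]; simp [wedgeVecBivec]
    · rw [H.concomitant W hW hxW α X hα hX]; simp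
    · rw [H.nijenhuis W hW hxW X Y hX hY]; simp
    · rw [H.associated W hW hxW X Y Z hX hY hZ]; simp [wedgeOneTwo]
  · intro H
    refine ⟨fun W hW hxW α β γ hα hβ hγ => ?_, fun W hW hxW α X hα hX => ?_,
      fun W hW hxW X Y hX hY => ?_, fun W hW hxW X Y Z hX hY hZ => ?_⟩
    · rw [(key1 W hW hxW α β γ hα hβ hγ).2 (H.poisson W hW hxW α β γ hα hβ hγ)]
      simp [wedgeVecBivec]
    · rw [(key2 W hW hxW α X hα).2 (H.concomitant W hW hxW α X hα hX)]; simp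
    · rw [(key3 W hW hxW X Y hX hY).2 (H.nijenhuis W hW hxW X Y hX hY)]; simp
    · rw [(key4 W hW hxW X Y Z hX hY hZ).2 (H.associated W hW hxW X Y Z hX hY hZ)]
      simp [wedgeOneTwo]

/-- The hinge of the proof: integrability after the change is a condition at each point on dτ alone,
so both the local and the global statement become questions about covectors. -/
theorem integrableOn_conformalConj_iff (Φ : GenAlmostComplex E M) {τ : M → ℝ} {U : Set M}
    (hU : IsOpen U) (hτ : ContMDiffOn 𝓘(ℝ, E) 𝓘(ℝ, ℝ) ∞ τ U) :
    IntegrableOn (conformalConj τ Φ.toEnd) U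
      ↔ ∀ x ∈ U, LeeAt Φ.A Φ.sharp Φ.flat x (diff τ x) := by
  have h := Φ.isAlmostComplexTriple
  have h' := h.conformal (subset_univ U) hτ
  have : IntegrableOn (conformalConj τ Φ.toEnd) U ↔ ∀ x ∈ U, ∀ V : Set M, IsOpen V → x ∈ V →
      V ⊆ U → ∀ ξ η : BigField E M, SmoothBigOn ξ V → SmoothBigOn η V →
        nijenhuisBig (conformalConj τ Φ.toEnd) ξ η x = 0 :=
    ⟨fun H x _ V hV hxV hVU ξ η hξ hη => H V hV hVU ξ η hξ hη x hxV,
      fun H V hV hVU ξ η hξ hη x hxV => H x (hVU hxV) V hV hxV hVU ξ η hξ hη⟩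
  rw [this, Φ.toEnd_eq_ofTriple, conformalConj_ofTriple]
  refine forall₂_congr fun x hx => ?_
  rw [nijenhuisBig_eq_zero_iff_leeAt_zero h' hU hx,
    leeAt_conformal_iff h hU (subset_univ U) hτ hx]

end ConformalChange

/-! ### Differentials, closed 1-forms and the Poincaré lemma, through coordinate fields. -/

section ClosedForms

variable {E : Type*} [NormedAddCommGroup E] [NormedSpace ℝ E] [FiniteDimensional ℝ E]
  {M : Type*} [TopologicalSpace M] [ChartedSpace E M] [IsManifold 𝓘(ℝ, E) ∞ M]

theorem smoothFormOn_diff {τ : M → ℝ} {U : Set M} (hU : IsOpen U)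
    (hτ : ContMDiffOn 𝓘(ℝ, E) 𝓘(ℝ, ℝ) ∞ τ U) : SmoothFormOn (diff τ : OneForm E M) U := by
  intro x hx
  have h := ContMDiffAt.mfderiv_const (I := 𝓘(ℝ, E)) (I' := 𝓘(ℝ, ℝ)) (m := ∞)
    (hτ.contMDiffAt (hU.mem_nhds hx)) (by simp)
  refine ContMDiffAt.contMDiffWithinAt ?_
  refine (contMDiffAt_hom_bundle _).2 ⟨contMDiffAt_id, ?_⟩
  convert h using 1
  funext y
  ext v
  simp [inTangentCoordinates, ContinuousLinearMap.inCoordinates, diff, mvfderiv]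
  rfl

theorem dirDeriv_congr (X : VecField E M) {f g : M → ℝ} {x : M} (h : f =ᶠ[nhds x] g) :
    dirDeriv X f x = dirDeriv X g x :=
  congrArg (fun L : E →L[ℝ] ℝ => L (X x)) (h.mfderiv_eq (I := 𝓘(ℝ, E)) (I' := 𝓘(ℝ, ℝ)))

/-- The vector field with constant coefficients `v` in the chart at `x₀`. -/
def chartField (x₀ : M) (v : E) : VecField E M :=
  VectorField.mpullback 𝓘(ℝ, E) 𝓘(ℝ, E) (extChartAt 𝓘(ℝ, E) x₀) (fun _ => v)

theorem contMDiffAt_const_field (v : E) (e : E) :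
    ContMDiffAt 𝓘(ℝ, E) (𝓘(ℝ, E).prod 𝓘(ℝ, E)) ∞
      (fun y => (TotalSpace.mk' E y v : TangentBundle 𝓘(ℝ, E) E)) e :=
  contMDiffWithinAt_vectorSpace_iff_contDiffWithinAt.2 contDiffWithinAt_const

theorem mdiffAt_const_field (v : E) (e : E) :
    MDifferentiableAt 𝓘(ℝ, E) (𝓘(ℝ, E).prod 𝓘(ℝ, E))
      (fun y => (TotalSpace.mk' E y v : TangentBundle 𝓘(ℝ, E) E)) e :=
  (contMDiffAt_const_field v e).mdifferentiableAt (by simp)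

theorem smoothVecOn_chartField (x₀ : M) (v : E) :
    SmoothVecOn (chartField x₀ v) (extChartAt 𝓘(ℝ, E) x₀).source := by
  intro x hx
  refine (ContMDiffAt.mpullback_vectorField_preimage (n := ∞) (contMDiffAt_const_field v _)
    (contMDiffAt_extChartAt' (by simpa using hx)) (isInvertible_mfderiv_extChartAt hx)
    (by simp)).contMDiffWithinAt

/-- Pullback by the chart commutes with brackets, and constant fields on `E` commute. -/
theorem lie_chartField (x₀ : M) (u v : E) {x : M} (hx : x ∈ (extChartAt 𝓘(ℝ, E) x₀).source) :
    lie (chartField x₀ u) (chartField x₀ v) x = 0 := by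
  have : IsManifold 𝓘(ℝ, E) (minSmoothness ℝ 3) M := by
    simp only [minSmoothness_of_isRCLikeNormedField]
    exact IsManifold.of_le (n := ∞) (by exact WithTop.coe_le_coe.2 le_top)
  have h := VectorField.mpullback_mlieBracket (I := 𝓘(ℝ, E)) (I' := 𝓘(ℝ, E)) (n := ∞)
    (f := extChartAt 𝓘(ℝ, E) x₀) (x₀ := x) (mdiffAt_const_field u _) (mdiffAt_const_field v _)
    (contMDiffAt_extChartAt' (by simpa using hx)) (by
      simp only [minSmoothness_of_isRCLikeNormedField]
      exact WithTop.coe_le_coe.2 le_top)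
  refine h.symm.trans ?_
  have e : VectorField.mlieBracket 𝓘(ℝ, E) (fun _ : E => u) (fun _ : E => v)
      (extChartAt 𝓘(ℝ, E) x₀ x) = 0 :=
    (congrFun (VectorField.mlieBracketWithin_eq_lieBracketWithin (s := univ)) _).trans
      (by simp [VectorField.lieBracketWithin]; rfl)
  exact (congrArg _ e).trans (map_zero _)

theorem dirDeriv_chartField (x₀ : M) (v : E) {f : M → ℝ} {x : M}
    (hx : x ∈ (extChartAt 𝓘(ℝ, E) x₀).source) (hf : MDifferentiableAt 𝓘(ℝ, E) 𝓘(ℝ, ℝ) f x) :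
    dirDeriv (chartField x₀ v) f x
      = fderiv ℝ (fun e => f ((extChartAt 𝓘(ℝ, E) x₀).symm e)) (extChartAt 𝓘(ℝ, E) x₀ x) v := by
  have hφ : MDifferentiableAt 𝓘(ℝ, E) 𝓘(ℝ, E) (extChartAt 𝓘(ℝ, E) x₀) x :=
    mdifferentiableAt_extChartAt (by simpa using hx)
  have hx' := (extChartAt 𝓘(ℝ, E) x₀).map_source hx
  have hψ : MDifferentiableAt 𝓘(ℝ, E) 𝓘(ℝ, E) (extChartAt 𝓘(ℝ, E) x₀).symm
      (extChartAt 𝓘(ℝ, E) x₀ x) :=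
    ((contMDiffOn_extChartAt_symm (n := ∞) x₀).contMDiffAt
      ((isOpen_extChartAt_target x₀).mem_nhds hx')).mdifferentiableAt (by simp)
  have hg : MDifferentiableAt 𝓘(ℝ, E) 𝓘(ℝ, ℝ)
      (f ∘ (extChartAt 𝓘(ℝ, E) x₀).symm) (extChartAt 𝓘(ℝ, E) x₀ x) :=
    MDifferentiableAt.comp_of_eq _ hf hψ ((extChartAt 𝓘(ℝ, E) x₀).left_inv hx)
  have he : f =ᶠ[nhds x] (f ∘ (extChartAt 𝓘(ℝ, E) x₀).symm) ∘ extChartAt 𝓘(ℝ, E) x₀ := by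
    filter_upwards [extChartAt_source_mem_nhds' hx] with y hy
    exact (congrArg f ((extChartAt 𝓘(ℝ, E) x₀).left_inv hy)).symm
  rw [dirDeriv_congr _ he]
  have hc := mfderiv_comp x hg hφ
  refine (congrArg (fun L => L (chartField x₀ v x)) hc).trans ?_
  have hinv : mfderiv 𝓘(ℝ, E) 𝓘(ℝ, E) (extChartAt 𝓘(ℝ, E) x₀) x (chartField x₀ v x) = v :=
    congrArg (fun L : E →L[ℝ] E => L v) (isInvertible_mfderiv_extChartAt hx).self_comp_inverse
  exact (congrArg _ hinv).trans
    (congrArg (fun L : E →L[ℝ] ℝ => L v) mfderiv_eq_fderiv)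

theorem exists_chartField_eq (x₀ : M) {x : M} (hx : x ∈ (extChartAt 𝓘(ℝ, E) x₀).source)
    (w : TangentSpace 𝓘(ℝ, E) x) : ∃ v, chartField x₀ v x = w := by
  obtain ⟨e, he⟩ := isInvertible_mfderiv_extChartAt hx
  refine ⟨e w, ?_⟩
  change (mfderiv 𝓘(ℝ, E) 𝓘(ℝ, E) (extChartAt 𝓘(ℝ, E) x₀) x).inverse (e w) = w
  rw [← he]
  exact (congrArg (fun L => L (e w)) (ContinuousLinearMap.inverse_equiv e)).trans
    (e.symm_apply_apply w)

/-- Because dβ(X, Z) = (L_X β)(Z) - Z(β(X)), this follows from tensoriality of the Lie derivative;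
the last term is visibly linear in the value of Z. -/
theorem tensorialAt_extDerivOne {β : OneForm E M} {X : VecField E M} {U : Set M} (hU : IsOpen U)
    (hβ : SmoothFormOn β U) {x : M} (hx : x ∈ U) :
    TensorialAt 𝓘(ℝ, E) E (fun Z : VecField E M => extDerivOne β X Z x) x where
  smul := by
    intro f Z hf hZ
    have h := (tensorialAt_lieDeriv (X := X) hU hβ hx).smul hf hZ
    have e : dirDeriv (f • Z) (fun y => β y (X y)) x
        = f x * dirDeriv Z (fun y => β y (X y)) x := by simp [dirDeriv]
    simp only [extDerivOne, smul_eq_mul] at h ⊢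
    linarith
  add := by
    intro Z W hZ hW
    have h := (tensorialAt_lieDeriv (X := X) hU hβ hx).add hZ hW
    have e : dirDeriv (Z + W) (fun y => β y (X y)) x
        = dirDeriv Z (fun y => β y (X y)) x + dirDeriv W (fun y => β y (X y)) x := by
      simp [dirDeriv]
    simp only [extDerivOne] at h ⊢
    linarith

theorem extDerivOne_swap (β : OneForm E M) (X Y : VecField E M) (x : M) :
    extDerivOne β X Y x = - extDerivOne β Y X x := by
  simp only [extDerivOne]
  rw [lie_swap X Y, map_neg]
  ring

/-- Tensoriality, used in each slot by means of a swap, replaces X and Y by commuting coordinate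
fields. What remains is symmetry of the second derivative of τ in the chart. -/
theorem extDerivOne_diff {τ : M → ℝ} {U : Set M} (hU : IsOpen U)
    (hτ : ContMDiffOn 𝓘(ℝ, E) 𝓘(ℝ, ℝ) ∞ τ U) {X Y : VecField E M} (hX : SmoothVecOn X U)
    (hY : SmoothVecOn Y U) {x : M} (hx : x ∈ U) : extDerivOne (diff τ) X Y x = 0 := by
  have hd := smoothFormOn_diff hU hτ
  have hsrc : x ∈ (extChartAt 𝓘(ℝ, E) x).source := mem_extChartAt_source x
  have hc : ∀ v, MDifferentiableAt 𝓘(ℝ, E) (𝓘(ℝ, E).prod 𝓘(ℝ, E))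
      (fun y => (TotalSpace.mk' E y (chartField x v y) : TangentBundle 𝓘(ℝ, E) M)) x := fun v =>
    (smoothVecOn_chartField x v).mdiffAt (isOpen_extChartAt_source x) hsrc
  obtain ⟨u, hu⟩ := exists_chartField_eq x hsrc (X x)
  obtain ⟨v, hv⟩ := exists_chartField_eq x hsrc (Y x)
  have h1 : extDerivOne (diff τ) X Y x = extDerivOne (diff τ) X (chartField x v) x :=
    (tensorialAt_extDerivOne hU hd hx).pointwise (hY.mdiffAt hU hx) (hc v) hv.symm
  have h2 : extDerivOne (diff τ) (chartField x v) X x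
      = extDerivOne (diff τ) (chartField x v) (chartField x u) x :=
    (tensorialAt_extDerivOne hU hd hx).pointwise (hX.mdiffAt hU hx) (hc u) hu.symm
  rw [h1, extDerivOne_swap, h2, neg_eq_zero]
  set φ := extChartAt 𝓘(ℝ, E) x with hφ
  have hW : IsOpen (φ.target ∩ φ.symm ⁻¹' U) :=
    (continuousOn_extChartAt_symm x).isOpen_inter_preimage (isOpen_extChartAt_target x) hU
  have hxW : φ x ∈ φ.target ∩ φ.symm ⁻¹' U :=
    ⟨φ.map_source hsrc, by simpa [φ.left_inv hsrc] using hx⟩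
  have hs : ContDiffOn ℝ ∞ (fun e => τ (φ.symm e)) (φ.target ∩ φ.symm ⁻¹' U) := by
    rw [← contMDiffOn_iff_contDiffOn]
    exact hτ.comp ((contMDiffOn_extChartAt_symm x).mono inter_subset_left) inter_subset_right
  have key : ∀ w, ∀ e ∈ φ.target ∩ φ.symm ⁻¹' U,
      diff τ (φ.symm e) (chartField x w (φ.symm e)) = fderiv ℝ (fun e => τ (φ.symm e)) e w := by
    intro w e he
    have hτe := (hτ.contMDiffAt (hU.mem_nhds he.2)).mdifferentiableAt (by simp)
    have := dirDeriv_chartField x w (φ.map_target he.1) hτe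
    rw [φ.right_inv he.1] at this
    exact this
  have hdd : DifferentiableAt ℝ (fderiv ℝ (fun e => τ (φ.symm e))) (φ x) :=
    (((contDiffOn_infty_iff_fderiv_of_isOpen hW).1 hs).2.differentiableOn (by simp)).differentiableAt
      (hW.mem_nhds hxW)
  have key2 : ∀ w z, dirDeriv (chartField x w)
      (fun y => diff τ y (chartField x z y)) x
      = fderiv ℝ (fderiv ℝ (fun e => τ (φ.symm e))) (φ x) w z := by
    intro w z
    rw [dirDeriv_chartField x w hsrc (hd.mdifferentiableAt_apply hU hx (hc z))]
    have : (fun e => diff τ (φ.symm e) (chartField x z (φ.symm e)))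
        =ᶠ[nhds (φ x)] fun e => fderiv ℝ (fun e => τ (φ.symm e)) e z := by
      filter_upwards [hW.mem_nhds hxW] with e he using key z e he
    rw [this.fderiv_eq, fderiv_clm_apply hdd (by fun_prop)]
    simp
  have hsymm : IsSymmSndFDerivAt ℝ (fun e => τ (φ.symm e)) (φ x) :=
    (hs.contDiffAt (hW.mem_nhds hxW)).isSymmSndFDerivAt (by
      simp only [minSmoothness_of_isRCLikeNormedField]
      exact WithTop.coe_le_coe.2 le_top)
  rw [extDerivOne, key2, key2, lie_chartField x v u hsrc, map_zero, sub_zero, sub_eq_zero]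
  exact hsymm.eq _ _

/-- The Poincaré lemma: a closed 1-form is locally the differential of a function. -/
theorem IsClosedForm.exists_eq_diff {ϖ : OneForm E M} (hc : IsClosedForm ϖ)
    (hs : SmoothFormOn ϖ univ) (x : M) :
    ∃ U : Set M, IsOpen U ∧ x ∈ U ∧ ∃ τ : M → ℝ, ContMDiffOn 𝓘(ℝ, E) 𝓘(ℝ, ℝ) ∞ τ U ∧
      ∀ y ∈ U, ϖ y = diff τ y := by
  set φ := extChartAt 𝓘(ℝ, E) x with hφ
  have hsrc : x ∈ φ.source := mem_extChartAt_source x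
  -- `w` is the coordinate expression of the form. Routing it through `W` allows its value at `φ y`
  -- to be found later by rewriting the base point alone.
  let W : M → E →L[ℝ] ℝ := fun y =>
    (ϖ y : E →L[ℝ] ℝ) ∘L
      ((mfderiv 𝓘(ℝ, E) 𝓘(ℝ, E) φ y : E →L[ℝ] E).inverse)
  let w : E → E →L[ℝ] ℝ := fun e => W (φ.symm e)
  have hwv : ∀ e v, w e v = ϖ (φ.symm e) (chartField x v (φ.symm e)) := fun e v => rfl
  have hsm : ∀ v, ContMDiffOn 𝓘(ℝ, E) 𝓘(ℝ, ℝ) ∞ (fun y => ϖ y (chartField x v y)) φ.source :=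
    fun v => (hs.mono (subset_univ _)).apply (smoothVecOn_chartField x v)
  have hw : ContDiffOn ℝ ∞ w φ.target := by
    rw [contDiffOn_clm_apply]
    intro v
    rw [← contMDiffOn_iff_contDiffOn]
    exact (hsm v).comp (contMDiffOn_extChartAt_symm x) fun e he => φ.map_target he
  have hopen : IsOpen φ.target := isOpen_extChartAt_target x
  -- A ball is taken because integrating `w` needs a convex domain, which the chart target need not
  -- be.
  obtain ⟨r, hr, hball⟩ := Metric.isOpen_iff.1 hopen _ (φ.map_source hsrc)
  have hdiff : DifferentiableOn ℝ w (Metric.ball (φ x) r) :=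
    (hw.differentiableOn (by simp)).mono hball
  have hder : ∀ a ∈ Metric.ball (φ x) r, ∀ u v, fderiv ℝ w a u v
      = dirDeriv (chartField x u) (fun y => ϖ y (chartField x v y)) (φ.symm a) := by
    intro a ha u v
    have hy := φ.map_target (hball ha)
    rw [dirDeriv_chartField x u hy (((hsm v).contMDiffAt
      ((isOpen_extChartAt_source x).mem_nhds hy)).mdifferentiableAt (by simp)),
      φ.right_inv (hball ha)]
    have hwa : DifferentiableAt ℝ w a := hdiff.differentiableAt (Metric.isOpen_ball.mem_nhds ha)
    have := fderiv_clm_apply hwa (differentiableAt_const v)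
    have h2 := congrArg (fun L => L u) this
    simp at h2
    exact h2.symm
  -- Closedness on coordinate fields, whose bracket vanishes, is exactly symmetry of the derivative
  -- of `w`.
  obtain ⟨f, hf⟩ := (convex_ball (φ x) r).exists_forall_hasFDerivAt_of_fderiv_symmetric
    Metric.isOpen_ball hdiff (by
      intro a ha u v
      have hy := φ.map_target (hball ha)
      have h0 := hc φ.source (isOpen_extChartAt_source x) _ _ (smoothVecOn_chartField x u)
        (smoothVecOn_chartField x v) _ hy
      rw [extDerivOne, lie_chartField x u v hy, map_zero, sub_zero, sub_eq_zero] at h0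
      rw [hder a ha, hder a ha, h0])
  have hfs : ContDiffOn ℝ ∞ f (Metric.ball (φ x) r) := by
    rw [contDiffOn_infty_iff_fderiv_of_isOpen Metric.isOpen_ball]
    refine ⟨fun a ha => (hf a ha).differentiableAt.differentiableWithinAt, ?_⟩
    exact (hw.mono hball).congr fun a ha => (hf a ha).fderiv
  refine ⟨φ.source ∩ φ ⁻¹' Metric.ball (φ x) r,
    (continuousOn_extChartAt x).isOpen_inter_preimage (isOpen_extChartAt_source x)
      Metric.isOpen_ball, ⟨hsrc, Metric.mem_ball_self hr⟩, fun y => f (φ y), ?_, ?_⟩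
  · have hφs : ContMDiffOn 𝓘(ℝ, E) 𝓘(ℝ, E) ∞ φ φ.source := by
      simpa [hφ] using contMDiffOn_extChartAt (I := 𝓘(ℝ, E)) (n := ∞) (x := x)
    exact (contMDiffOn_iff_contDiffOn.2 hfs).comp (hφs.mono inter_subset_left) inter_subset_right
  · rintro y ⟨hy, hyb⟩
    have hφy : MDifferentiableAt 𝓘(ℝ, E) 𝓘(ℝ, E) φ y :=
      mdifferentiableAt_extChartAt (by simpa [hφ] using hy)
    have hcomp := ((hf (φ y) hyb).hasMFDerivAt.comp y hφy.hasMFDerivAt).mfderiv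
    ext z
    refine Eq.trans ?_ (congrArg (fun L : E →L[ℝ] ℝ => L z) hcomp).symm
    have hwy : w (φ y) = W y := congrArg W (φ.left_inv hy)
    have hinv : (mfderiv 𝓘(ℝ, E) 𝓘(ℝ, E) φ y : E →L[ℝ] E).inverse
        (mfderiv 𝓘(ℝ, E) 𝓘(ℝ, E) φ y z) = z :=
      congrArg (fun L : E →L[ℝ] E => L z) (isInvertible_mfderiv_extChartAt hy).inverse_comp_self
    change ϖ y z = w (φ y) (mfderiv 𝓘(ℝ, E) 𝓘(ℝ, E) φ y z)
    rw [hwy]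
    change ϖ y z = ϖ y _
    exact congrArg (ϖ y) hinv.symm

end ClosedForms

/-! ### Linear constraints on the difference of two Lee covectors. -/

section Uniqueness

variable {E : Type*} [NormedAddCommGroup E] [NormedSpace ℝ E] [FiniteDimensional ℝ E]
  {M : Type*} [TopologicalSpace M] [ChartedSpace E M] [IsManifold 𝓘(ℝ, E) ∞ M]

variable {A : EndField E M} {P : SharpField E M} {S : FlatField E M} {U : Set M} {x : M}
  {κ κ' : TangentSpace 𝓘(ℝ, E) x →L[ℝ] ℝ}

/-- The left side of (i) does not involve the covector, so subtracting two instances leaves a purely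
algebraic identity for `κ - κ'`. The next two lemmas treat (ii) and (iii) in the same way. -/
theorem LeeAt.wedge_sub_eq_zero (h : LeeAt A P S x κ) (h' : LeeAt A P S x κ')
    (a b c : TangentSpace 𝓘(ℝ, E) x →L[ℝ] ℝ) :
    wedgeVecBivec (P x (κ - κ')) (P x) a b c = 0 := by
  obtain ⟨U, hU, hxU, α, hα, rfl⟩ := exists_smoothFormOn x a
  obtain ⟨V, hV, hxV, β, hβ, rfl⟩ := exists_smoothFormOn x b
  obtain ⟨W, hW, hxW, γ, hγ, rfl⟩ := exists_smoothFormOn x c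
  have hO : IsOpen (U ∩ V ∩ W) := (hU.inter hV).inter hW
  have hα' := hα.mono (fun y (hy : y ∈ U ∩ V ∩ W) => hy.1.1)
  have hβ' := hβ.mono (fun y (hy : y ∈ U ∩ V ∩ W) => hy.1.2)
  have hγ' := hγ.mono (fun y (hy : y ∈ U ∩ V ∩ W) => hy.2)
  have e := h.poisson _ hO ⟨⟨hxU, hxV⟩, hxW⟩ α β γ hα' hβ' hγ'
  have e' := h'.poisson _ hO ⟨⟨hxU, hxV⟩, hxW⟩ α β γ hα' hβ' hγ'
  simp only [wedgeVecBivec, map_sub] at *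
  linarith

/-- Where `κ - κ'` does not vanish on `u`, every nonzero vector in the image of ♯ becomes an
eigenvector of A. -/
theorem LeeAt.sub_smul_eq (h : LeeAt A P S x κ) (h' : LeeAt A P S x κ')
    (a : TangentSpace 𝓘(ℝ, E) x →L[ℝ] ℝ) (u : TangentSpace 𝓘(ℝ, E) x) :
    (κ - κ') u • A x (P x a) = (κ - κ') (A x u) • P x a := by
  obtain ⟨U, hU, hxU, α, hα, rfl⟩ := exists_smoothFormOn x a
  obtain ⟨V, hV, hxV, X, hX, rfl⟩ := exists_smoothVecOn x u
  have e := h.concomitant _ (hU.inter hV) ⟨hxU, hxV⟩ α X (hα.mono inter_subset_left)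
    (hX.mono inter_subset_right)
  rw [h'.concomitant _ (hU.inter hV) ⟨hxU, hxV⟩ α X (hα.mono inter_subset_left)
    (hX.mono inter_subset_right), sub_eq_sub_iff_add_eq_add] at e
  simp only [sub_apply, sub_smul]
  rw [sub_eq_sub_iff_add_eq_add, ← e]
  abel

theorem LeeAt.sub_nijenhuis_eq (h : LeeAt A P S x κ) (h' : LeeAt A P S x κ')
    (u v : TangentSpace 𝓘(ℝ, E) x) :
    (κ - κ') u • (v + A x (A x v)) - (κ - κ') v • (u + A x (A x u))
      = S x u v • P x (κ - κ') := by
  obtain ⟨U, hU, hxU, X, hX, rfl⟩ := exists_smoothVecOn x u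
  obtain ⟨V, hV, hxV, Y, hY, rfl⟩ := exists_smoothVecOn x v
  have e := h.nijenhuis _ (hU.inter hV) ⟨hxU, hxV⟩ X Y (hX.mono inter_subset_left)
    (hY.mono inter_subset_right)
  rw [h'.nijenhuis _ (hU.inter hV) ⟨hxU, hxV⟩ X Y (hX.mono inter_subset_left)
    (hY.mono inter_subset_right), ← sub_eq_zero] at e
  rw [← sub_eq_zero, ← neg_eq_zero, ← e]
  simp only [sub_apply, map_sub]
  module

end Uniqueness

/-! ### Rank estimates. -/

section LinearAlgebra

theorem finrank_le_two_of_range_le_span {V : Type*} [AddCommGroup V] [Module ℝ V] {v w : V}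
    {N : Submodule ℝ V} (h : N ≤ Submodule.span ℝ {v, w}) : Module.finrank ℝ N ≤ 2 := by
  have hfin : Module.Finite ℝ (Submodule.span ℝ ({v, w} : Set V)) :=
    Module.Finite.span_of_finite ℝ (by simp)
  refine (Submodule.finrank_mono h).trans ?_
  classical
  have := finrank_span_finset_le_card (R := ℝ) ({v, w} : Finset V)
  rw [Finset.coe_pair] at this
  exact this.trans Finset.card_le_two

variable {E : Type*} [NormedAddCommGroup E] [NormedSpace ℝ E] [FiniteDimensional ℝ E]
  {M : Type*} [TopologicalSpace M] [ChartedSpace E M] [IsManifold 𝓘(ℝ, E) ∞ M]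

/-- A vector whose wedge product with a bivector of rank greater than two vanishes is zero. -/
theorem eq_zero_of_wedgeVecBivec_eq_zero {x : M}
    {P : (TangentSpace 𝓘(ℝ, E) x →L[ℝ] ℝ) →ₗ[ℝ] TangentSpace 𝓘(ℝ, E) x}
    (hP : ∀ α β : TangentSpace 𝓘(ℝ, E) x →L[ℝ] ℝ, α (P β) = - β (P α))
    (hrank : 2 < Module.finrank ℝ (LinearMap.range P)) {v : TangentSpace 𝓘(ℝ, E) x}
    (h : ∀ a b c, wedgeVecBivec v P a b c = 0) : v = 0 := by
  by_contra hv
  have hsep : SeparatingDual ℝ (TangentSpace 𝓘(ℝ, E) x) := inferInstanceAs (SeparatingDual ℝ E)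
  obtain ⟨a, ha⟩ := SeparatingDual.exists_eq_one (R := ℝ) hv
  -- Contracting v ∧ π = 0 with a covector normalised by `a v = 1` writes π as a wedge of `v` and `P
  -- a`, hence with rank at most two.
  have key : ∀ β, P β = β v • P a - β (P a) • v := by
    intro β
    rw [← sub_eq_zero]
    by_contra hne
    obtain ⟨c, hc⟩ := SeparatingDual.exists_ne_zero (R := ℝ) hne
    apply hc
    have := h a β c
    simp only [wedgeVecBivec, ha] at this
    simp only [map_sub, map_smul, smul_eq_mul]
    rw [hP a c] at this
    linarith
  refine absurd (finrank_le_two_of_range_le_span (v := P a) (w := v) ?_) (not_le.2 hrank)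
  rintro _ ⟨β, rfl⟩
  rw [key β]
  exact Submodule.sub_mem _ (Submodule.smul_mem _ _ (Submodule.subset_span (by simp)))
    (Submodule.smul_mem _ _ (Submodule.subset_span (by simp)))

end LinearAlgebra

/-! ### Pointwise uniqueness of the Lee covector and gluing of local differentials. -/

section Main

variable {E : Type*} [NormedAddCommGroup E] [NormedSpace ℝ E] [FiniteDimensional ℝ E]
  {M : Type*} [TopologicalSpace M] [ChartedSpace E M] [IsManifold 𝓘(ℝ, E) ∞ M]

/-- The pointwise nondegeneracy alternatives under which the Lee form is unique. -/
def LeeNondegAt (Φ : GenAlmostComplex E M) (x : M) : Prop :=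
  Φ.PiNondegAt x ∨
    (Φ.A x ∘ₗ Φ.A x ≠ -LinearMap.id ∧ ∀ c : ℝ, ¬ Module.End.HasEigenvalue (Φ.A x) c) ∨
    (2 < Φ.rankPi x ∧ Φ.SigmaNondegAt x)

theorem LeeNondegAt.leeAt_unique (hdim : 2 < Module.finrank ℝ E) {Φ : GenAlmostComplex E M} {x : M}
    (hx : LeeNondegAt Φ x) {κ κ' : TangentSpace 𝓘(ℝ, E) x →L[ℝ] ℝ}
    (h : LeeAt Φ.A Φ.sharp Φ.flat x κ) (h' : LeeAt Φ.A Φ.sharp Φ.flat x κ') : κ = κ' := by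
  have ht := Φ.isAlmostComplexTriple
  have hfin : FiniteDimensional ℝ (TangentSpace 𝓘(ℝ, E) x) :=
    inferInstanceAs (FiniteDimensional ℝ E)
  rw [← sub_eq_zero]
  rcases hx with hx | ⟨hA, hE⟩ | ⟨hr, hS⟩
  · have hr : 2 < Module.finrank ℝ (LinearMap.range (Φ.sharp x)) := by
      rw [LinearMap.range_eq_top.2 hx.2, finrank_top]
      exact hdim
    have := eq_zero_of_wedgeVecBivec_eq_zero (ht.sharp_skew x) hr (h.wedge_sub_eq_zero h')
    exact hx.1 (this.trans (map_zero _).symm)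
  · by_contra hκ
    obtain ⟨u, hu⟩ : ∃ u, (κ - κ') u ≠ 0 := by
      by_contra hn
      push Not at hn
      exact hκ (ContinuousLinearMap.ext hn)
    -- A² ≠ -Id is the same as ♯♭ ≠ 0. The resulting vector in the image of ♯ is the forbidden
    -- eigenvector.
    obtain ⟨w, hw⟩ : ∃ w, Φ.sharp x (Φ.flat x w) ≠ 0 := by
      by_contra hn
      push Not at hn
      apply hA
      ext w
      have := ht.sq x w
      rw [hn, add_zero] at this
      simpa using this
    have e := h.sub_smul_eq h' (Φ.flat x w) u
    refine hE (((κ - κ') u)⁻¹ * (κ - κ') (Φ.A x u)) ?_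
    refine Module.End.hasEigenvalue_of_hasEigenvector (x := Φ.sharp x (Φ.flat x w))
      ⟨Module.End.mem_eigenspace_iff.2 ?_, hw⟩
    rw [mul_smul, ← e, inv_smul_smul₀ hu]
  · have hv := eq_zero_of_wedgeVecBivec_eq_zero (ht.sharp_skew x) hr (h.wedge_sub_eq_zero h')
    by_contra hκ
    obtain ⟨u, hu⟩ : ∃ u, (κ - κ') u ≠ 0 := by
      by_contra hn
      push Not at hn
      exact hκ (ContinuousLinearMap.ext hn)
    -- With ♯(κ - κ') = 0, the difference of (iii) places the image of Id + A² = -♯♭ on one line. As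
    -- ♭ is onto, that line contains the image of ♯; the zero vector merely fits it to the bound for
    -- two vectors.
    refine absurd (finrank_le_two_of_range_le_span (v := u + Φ.A x (Φ.A x u)) (w := 0) ?_)
      (not_le.2 hr)
    rintro _ ⟨β, rfl⟩
    obtain ⟨w, rfl⟩ := hS.2 β
    have e := h.sub_nijenhuis_eq h' u w
    rw [hv, smul_zero, sub_eq_zero] at e
    have e2 : Φ.sharp x (Φ.flat x w) = - (w + Φ.A x (Φ.A x w)) := by
      rw [neg_add, ← ht.sq x w]; abel
    have e3 : w + Φ.A x (Φ.A x w)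
        = (((κ - κ') u)⁻¹ * (κ - κ') w) • (u + Φ.A x (Φ.A x u)) := by
      rw [mul_smul, ← e, inv_smul_smul₀ hu]
    rw [e2, e3]
    exact Submodule.neg_mem _ (Submodule.smul_mem _ _ (Submodule.subset_span (by simp)))

theorem SmoothFormOn.congr {α β : OneForm E M} {U : Set M} (h : SmoothFormOn α U)
    (e : ∀ y ∈ U, β y = α y) : SmoothFormOn β U :=
  ContMDiffOn.congr h fun y hy => by rw [e y hy]

/-- A 1-form that is locally a differential is closed. -/
theorem isClosedForm_of_locally_eq_diff {ϖ : OneForm E M}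
    (h : ∀ x, ∃ U : Set M, IsOpen U ∧ x ∈ U ∧ ∃ τ : M → ℝ,
      ContMDiffOn 𝓘(ℝ, E) 𝓘(ℝ, ℝ) ∞ τ U ∧ ∀ y ∈ U, ϖ y = diff τ y) :
    IsClosedForm ϖ := by
  intro V hV X Y hX hY x hx
  obtain ⟨U, hU, hxU, τ, hτ, e⟩ := h x
  have := extDerivOne_diff (hU.inter hV) (hτ.mono inter_subset_left) (hX.mono inter_subset_right)
    (hY.mono inter_subset_right) ⟨hxU, hx⟩
  rw [← this]
  have hev : ∀ Z : VecField E M,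
      (fun y => ϖ y (Z y)) =ᶠ[nhds x] fun y => diff τ y (Z y) := fun Z => by
    filter_upwards [hU.mem_nhds hxU] with y hy
    rw [e y hy]
  simp only [extDerivOne]
  rw [dirDeriv_congr X (hev Y), dirDeriv_congr Y (hev X), e x hxU]

theorem smoothFormOn_of_locally_eq_diff {ϖ : OneForm E M}
    (h : ∀ x, ∃ U : Set M, IsOpen U ∧ x ∈ U ∧ ∃ τ : M → ℝ,
      ContMDiffOn 𝓘(ℝ, E) 𝓘(ℝ, ℝ) ∞ τ U ∧ ∀ y ∈ U, ϖ y = diff τ y) :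
    SmoothFormOn ϖ univ := by
  intro x _
  obtain ⟨U, hU, hxU, τ, hτ, e⟩ := h x
  exact (((smoothFormOn_diff hU hτ).congr e).contMDiffAt (hU.mem_nhds hxU)).contMDiffWithinAt

end Main

end GenCx

end

/-! ### Assembly of the theorem. -/

theorem theorem3p1
    {E : Type*} [NormedAddCommGroup E] [NormedSpace ℝ E] [FiniteDimensional ℝ E]
    {M : Type*} [TopologicalSpace M] [T2Space M] [SecondCountableTopology M]
    [ChartedSpace E M] [IsManifold 𝓘(ℝ, E) ∞ M]
    (hdim : 2 < Module.finrank ℝ E)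
    (Φ : GenCx.GenAlmostComplex E M)
    (hΦ : (∀ x, Φ.PiNondegAt x) ∨
      (∀ x, Φ.A x ∘ₗ Φ.A x ≠ -LinearMap.id ∧
        ∀ c : ℝ, ¬ Module.End.HasEigenvalue (Φ.A x) c) ∨
      (∀ x, 2 < Φ.rankPi x ∧ Φ.SigmaNondegAt x)) :
    (GenCx.LocallyConformalIntegrable Φ ↔
      ∃ ϖ : GenCx.OneForm E M, GenCx.SmoothFormOn ϖ Set.univ ∧
        GenCx.IsClosedForm ϖ ∧ GenCx.LeeConditions Φ ϖ) ∧
    (∀ ϖ : GenCx.OneForm E M, GenCx.SmoothFormOn ϖ Set.univ → GenCx.IsClosedForm ϖ →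
      GenCx.LeeConditions Φ ϖ →
      (GenCx.GloballyConformalIntegrable Φ ↔ GenCx.IsExactForm ϖ)) := by
  have hnd : ∀ x, GenCx.LeeNondegAt Φ x := fun x => by
    rcases hΦ with h | h | h
    · exact Or.inl (h x)
    · exact Or.inr (Or.inl (h x))
    · exact Or.inr (Or.inr (h x))
  refine ⟨⟨fun h => ?_, ?_⟩, fun ϖ hs hc hL => ⟨?_, ?_⟩⟩
  · choose U hU hxU τ hτ hI using h
    have hLee := fun x =>
      (GenCx.integrableOn_conformalConj_iff Φ (hU x) (hτ x)).1 (hI x)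
    -- The Lee form takes at each point `z` the differential of the function chosen for `z` itself.
    -- Uniqueness at a nearby `y` identifies it with the differential of the function chosen for
    -- `x`, so it is locally one differential.
    have hloc : ∀ x, ∃ V : Set M, IsOpen V ∧ x ∈ V ∧ ∃ t : M → ℝ,
        ContMDiffOn 𝓘(ℝ, E) 𝓘(ℝ, ℝ) ∞ t V ∧
          ∀ y ∈ V, (fun z => GenCx.diff (E := E) (τ z) z) y = GenCx.diff t y :=
      fun x => ⟨U x, hU x, hxU x, τ x, hτ x, fun y hy =>
        (hnd y).leeAt_unique hdim (hLee y y (hxU y)) (hLee x y hy)⟩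
    exact ⟨_, GenCx.smoothFormOn_of_locally_eq_diff hloc,
      GenCx.isClosedForm_of_locally_eq_diff hloc,
      (GenCx.leeConditions_iff Φ _).2 fun x => hLee x x (hxU x)⟩
  · rintro ⟨ϖ, hs, hc, hL⟩ x
    obtain ⟨U, hU, hxU, τ, hτ, e⟩ := hc.exists_eq_diff hs x
    refine ⟨U, hU, hxU, τ, hτ, (GenCx.integrableOn_conformalConj_iff Φ hU hτ).2 fun y hy => ?_⟩
    rw [← e y hy]
    exact (GenCx.leeConditions_iff Φ ϖ).1 hL y
  · rintro ⟨τ, hτ, hI⟩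
    refine ⟨τ, hτ, funext fun x => ?_⟩
    exact (hnd x).leeAt_unique hdim ((GenCx.leeConditions_iff Φ ϖ).1 hL x)
      ((GenCx.integrableOn_conformalConj_iff Φ isOpen_univ hτ.contMDiffOn).1 hI x trivial)
  · rintro ⟨τ, hτ, rfl⟩
    exact ⟨τ, hτ, (GenCx.integrableOn_conformalConj_iff Φ isOpen_univ hτ.contMDiffOn).2
      fun x _ => (GenCx.leeConditions_iff Φ _).1 hL x⟩
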